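/- **Theorem 1.7 (Conze–Lesigne equation).** Let $\Gamma$ be a countable torsion-free (discrete) abelian group. Let $Z=(Z,+)$ be a compact metrizable abelian group with Haar probability measure $\mu$ and Borel $\sigma$-algebra, on which $\Gamma$ acts by the rotations $S^\gamma z=\phi(\gamma)+z$ for some homomorphism $\phi\colon\Gamma\to Z$, and assume that this action is ergodic. Let $K=(K,+)$ be a compact abelian Lie group (not necessarily connected; for example $K=\frac1N\mathbb Z/\mathbb Z$). Let $\rho=(\rho_\gamma)_{\gamma\in\Gamma}$ be a $(Z,K)$-cocycle, i.e. a family of measurable maps $\rho_\gamma\colon Z\to K$ such that for all $\gamma_1,\gamma_2\in\Gamma$ one has $\rho_{\gamma_1+\gamma_2}=\rho_{\gamma_1}\circ S^{\gamma_2}+\rho_{\gamma_2}$ $\mu$-almost everywhere. Then the following are equivalent: (i) $\rho$ is of type $2$: there is a measurable $F\colon Z^{\{0,1\}^2}\to K$ such that for every $\gamma\in\Gamma$ and $\mu^{[2]}$-almost every $(y_\omega)_{\omega\in\{0,1\}^2}$, $$\sum_{\omega\in\{0,1\}^2}(-1)^{|\omega|}\rho_\gamma(y_\omega)=F\big((S^\gamma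 y_\omega)_\omega\big)-F\big((y_\omega)_\omega\big).$$ (ii) $\rho$ obeys the Conze–Lesigne equation: for every $z\in Z$ the derivative $\partial_{V_z}\rho$, $(\partial_{V_z}\rho)_\gamma(z')=\rho_\gamma(z+z')-\rho_\gamma(z')$, is a quasi-coboundary, i.e. there are a measurable $F_z\colon Z\to K$ and a homomorphism $c_z\colon\Gamma\to K$ such that for every $\gamma\in\Gamma$ and $\mu$-almost every $z'\in Z$, $$\rho_\gamma(z+z')-\rho_\gamma(z')=F_z(S^\gamma z')-F_z(z')+c_z(\gamma).$$ Here $\mu^{[k]}$ is the Host–Kra measure on $Z^{\{0,1\}^k}$, defined recursively by $\mu^{[0]}=\mu$ and, on $Z^{\{0,1\}^{k+1}}=Z^{\{0,1\}^k}\times Z^{\{0,1\}^k}$, by letting $\mu^{[k+1]}$ be the relatively independent product of $\mu^{[k]}$ with itself over the $\sigma$-algebra $\mathcal I_k$ of sets invariant (up to $\mu^{[k]}$-null sets) under the diagonal action of $\Gamma$; that is, $\mu^{[k+1]}(A\times B)=\int \mathbb E(1_A\mid\mathcal I_k)\,\mathbb E(1_B\mid\mathcal I_k)\,d\mu^{[k]}$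 for measurable $A,B\subseteq Z^{\{0,1\}^k}$. Also $|\omega|=\omega_1+\omega_2$. -/

import Mathlib

open MeasureTheory ProbabilityTheory

namespace ConzeLesigne

/-- Compact metrizable spaces are Polish; hence with their Borel sets they are standard Borel
spaces (Lebesgue spaces, once a probability measure is given). -/
instance (priority := 50) polishSpace_of_compact_metrizable (Z : Type*) [TopologicalSpace Z]
    [CompactSpace Z] [TopologicalSpace.MetrizableSpace Z] : PolishSpace Z := by
  let _ := TopologicalSpace.metrizableSpaceMetric Z
  infer_instance

section Systems

variable {Γ Y : Type*} [MeasurableSpace Y]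

/-- The `σ`-algebra of (almost everywhere) invariant measurable sets of a family of maps
`S γ : Y → Y`: the invariant factor of the system `(Y, μ, S)`. -/
@[reducible] def invariantAlgebra (μ : Measure Y) (S : Γ → Y → Y) : MeasurableSpace Y where
  MeasurableSet' A := MeasurableSet A ∧ ∀ γ, S γ ⁻¹' A =ᵐ[μ] A
  measurableSet_empty := ⟨MeasurableSet.empty, fun _ => by simp⟩
  measurableSet_compl A hA := ⟨hA.1.compl, fun γ => by
    rw [Set.preimage_compl]; exact (hA.2 γ).compl⟩
  measurableSet_iUnion A hA := ⟨MeasurableSet.iUnion fun i => (hA i).1, fun γ => by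
    rw [Set.preimage_iUnion]; exact Filter.EventuallyEq.countable_iUnion fun i => (hA i).2 γ⟩

theorem invariantAlgebra_le (μ : Measure Y) (S : Γ → Y → Y) :
    invariantAlgebra μ S ≤ (inferInstance : MeasurableSpace Y) :=
  fun _ hA => hA.1

/-- The system `(Y, μ, S)` is ergodic: its invariant factor is trivial. -/
def IsErgodicSystem (μ : Measure Y) (S : Γ → Y → Y) : Prop :=
  ∀ A : Set Y, MeasurableSet[invariantAlgebra μ S] A → μ A = 0 ∨ μ A = 1

/-- The relatively independent product `μ ×_I μ` of a probability measure with itself over a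
sub-`σ`-algebra `m`: the mixture `∫ (μ_y × μ_y) dμ(y)`, where `(μ_y)` is the disintegration
(regular conditional probability) of `μ` over `m`. -/
noncomputable def relIndepSquare {X : Type*} (m : MeasurableSpace X) [mX : MeasurableSpace X]
    [StandardBorelSpace X] (μ : ProbabilityMeasure X) (hm : m ≤ mX) : ProbabilityMeasure (X × X) :=
  let κ : Kernel X X := (condExpKernel (mΩ := mX) (μ : Measure X) m).comap id (measurable_id'' hm)
  ⟨(μ : Measure X).bind (κ ×ₖ κ), inferInstance⟩

/-- The diagonal action on the cube `Y^{{0,1}^k}`. -/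
def cubeAction (S : Γ → Y → Y) (k : ℕ) (γ : Γ) (y : (Fin k → Bool) → Y) : (Fin k → Bool) → Y :=
  fun v => S γ (y v)

/-- The identification `Y^{{0,1}^k} × Y^{{0,1}^k} ≅ Y^{{0,1}^(k+1)}`: the last coordinate of the
vertex `v` selects the half of the cube. -/
def glueCubes (k : ℕ) (p : ((Fin k → Bool) → Y) × ((Fin k → Bool) → Y)) :
    (Fin (k + 1) → Bool) → Y :=
  fun v => if v (Fin.last k) then p.2 (Fin.init v) else p.1 (Fin.init v)

theorem measurable_glueCubes (k : ℕ) : Measurable (glueCubes (Y := Y) k) := by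
  refine measurable_pi_lambda _ fun v => ?_
  unfold glueCubes
  split
  · exact (measurable_pi_apply _).comp measurable_snd
  · exact (measurable_pi_apply _).comp measurable_fst

/-- The Host--Kra measure `μ^{[k]}` on `Y^{{0,1}^k}`: `μ^{[0]} = μ`, and `μ^{[k+1]}` is the
relatively independent product of `μ^{[k]}` with itself over the invariant factor of
`(Y^{[k]}, μ^{[k]}, S^{[k]})`. -/
noncomputable def hostKraMeasure [StandardBorelSpace Y] (μ : ProbabilityMeasure Y)
    (S : Γ → Y → Y) : (k : ℕ) → ProbabilityMeasure ((Fin k → Bool) → Y)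
  | 0 => μ.map (f := fun y _ => y) (measurable_pi_lambda _ fun _ => measurable_id).aemeasurable
  | k + 1 =>
    (relIndepSquare
      (invariantAlgebra (hostKraMeasure μ S k : Measure ((Fin k → Bool) → Y)) (cubeAction S k))
      (hostKraMeasure μ S k) (invariantAlgebra_le _ _)).map (measurable_glueCubes k).aemeasurable

end Systems

section Cocycles

variable {Γ Y K : Type*} [AddCommGroup Γ] [MeasurableSpace Y] [AddCommGroup K] [MeasurableSpace K]

/-- `ρ` (a family of representatives `ρ γ : Y → K`) is a cocycle of the system `(Y, μ, S)` with
values in `K`. -/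
structure IsCocycle (μ : Measure Y) (S : Γ → Y → Y) (ρ : Γ → Y → K) : Prop where
  measurable : ∀ γ, Measurable (ρ γ)
  cocycle_eq : ∀ γ₁ γ₂, ∀ᵐ y ∂μ, ρ (γ₁ + γ₂) y = ρ γ₁ (S γ₂ y) + ρ γ₂ y

/-- `ρ = dF` almost everywhere for some measurable `F : Y → K`. -/
def IsCoboundary (μ : Measure Y) (S : Γ → Y → Y) (ρ : Γ → Y → K) : Prop :=
  ∃ F : Y → K, Measurable F ∧ ∀ γ, ∀ᵐ y ∂μ, ρ γ y = F (S γ y) - F y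

/-- `ρ = dF + c` almost everywhere for some measurable `F : Y → K` and some homomorphism
`c : Γ → K`. -/
def IsQuasiCoboundary (μ : Measure Y) (S : Γ → Y → Y) (ρ : Γ → Y → K) : Prop :=
  ∃ F : Y → K, Measurable F ∧ ∃ c : Γ →+ K, ∀ γ, ∀ᵐ y ∂μ, ρ γ y = F (S γ y) - F y + c γ

/-- The derivative `∂_V ρ = ρ ∘ V - ρ`. -/
def cocycleDerivative (V : Y → Y) (ρ : Γ → Y → K) : Γ → Y → K :=
  fun γ y => ρ γ (V y) - ρ γ y

/-- `(Δ^{[k]} ρ)_γ (y_v) = ∑_v (-1)^{|v|} ρ_γ (y_v)`. -/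
def cubeDifference (k : ℕ) (ρ : Γ → Y → K) : Γ → ((Fin k → Bool) → Y) → K :=
  fun γ y => ∑ v : Fin k → Bool, (-1 : ℤ) ^ (∑ i, (v i).toNat) • ρ γ (y v)

/-- `ρ` is of type (at most) `k`: `Δ^{[k]} ρ` is a coboundary of the Host--Kra parallelepiped
system `(Y^{[k]}, μ^{[k]}, S^{[k]})`. -/
def IsOfType [StandardBorelSpace Y] (μ : ProbabilityMeasure Y) (S : Γ → Y → Y) (k : ℕ)
    (ρ : Γ → Y → K) : Prop :=
  IsCoboundary (hostKraMeasure μ S k : Measure ((Fin k → Bool) → Y)) (cubeAction S k)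
    (cubeDifference k ρ)

end Cocycles

section Rotations

variable {Γ Z K : Type*} [AddCommGroup Γ] [AddCommGroup Z]

/-- The rotational action `S^γ z = φ(γ) + z` given by a homomorphism `φ : Γ → Z`. -/
def rotation (φ : Γ →+ Z) (γ : Γ) (z : Z) : Z := φ γ + z

/-- The Conze--Lesigne equation for a cocycle `ρ` of the rotational system given by `φ`: for
every `z`, the derivative of `ρ` along the translation `V_z : z' ↦ z + z'` is a
quasi-coboundary. -/
def ObeysConzeLesigne [MeasurableSpace Z] [AddCommGroup K] [MeasurableSpace K]
    (μ : Measure Z) (φ : Γ →+ Z) (ρ : Γ → Z → K) : Prop :=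
  ∀ z : Z, IsQuasiCoboundary μ (rotation φ) (cocycleDerivative (fun z' => z + z') ρ)

end Rotations

end ConzeLesigne

/-!
The Host--Kra measure of order two of an ergodic rotation is the law of a uniformly random
parallelogram `x`, `x + h`, `x + k`, `x + h + k` (`hostKraMeasure_two_eq_map`), because the ergodic
components of the diagonal action on `Z × Z` are the cosets of the diagonal. Type `2` therefore says
that `ρ (x + h + k) - ρ (x + h) - ρ (x + k) + ρ x` is the coboundary of a function of `(x, h, k)`.

If the Conze--Lesigne equation holds with solutions `F_h`, then `F_h (x + k) - F_h x` is such a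
function. Only the joint measurability has to be secured: solutions are coded by points of a Polish
space, the relation "`y` codes a solution at `h`" is Borel, and von Neumann's measurable selection
theorem applies (`ObeysConzeLesigne.isOfType_two`).

Conversely, type `2` gives, for almost every `h`, a function `G_h` on `Z × Z` with
`∂_h ρ (y) - ∂_h ρ (x) = G_h (S x, S y) - G_h (x, y)`. The key fact
(`exists_nhds_isQuasiCoboundary`) is that a cocycle `σ` with such a primitive `G` is a
quasi-coboundary if `G` is close to zero in measure. Indeed the defect
`I (x, y, z) = G (x, y) + G (y, z) - G (x, z)` is invariant, is a `2`-cocycle, and is mostly small.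
Subtracting from `G` the centre of the law of `I (x, y, ·)`, which is again an invariant function,
makes the defect uniformly small (`exists_small_defect_primitive`; here ergodicity enters). If the
values of `I` were in a vector space, the identity
`I (x, y, z) = I (x, y, w) + I (y, z, w) - I (x, z, w)` averaged over `w` would exhibit `I` as the
defect of an invariant function. In a Lie group this is true up to an error that is a small fraction
of the size of `I`, and an iteration removes the defect
(`ApproxLog.exists_additive_primitive`). Then `G (x, y) = F y - F x`, and `σ` differs from the
coboundary of `F` by a constant.

By continuity of translation, `G_h - G_{h - t}` is close to zero in measure for `t` near `0` and
suitable `h`, so that `∂_t ρ` is a quasi-coboundary for all `t` near `0`. The set of all such `t` is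
a subgroup containing `φ Γ`; being open it is all of `Z`, by ergodicity
(`IsOfType.obeysConzeLesigne`).
-/

namespace ConzeLesigne

/-! ### The Host--Kra measure of order two of an ergodic rotation -/

section RelativeSquare

variable {A H X : Type*} [MeasurableSpace A] [MeasurableSpace H] [mX : MeasurableSpace X]

theorem measurable_slice_measure (α : Measure A) [IsProbabilityMeasure α] {g : H × A → X}
    (hg : Measurable g) {B : Set X} (hB : MeasurableSet B) :
    Measurable fun h => α {a | g (h, a) ∈ B} :=
  measurable_measure_prodMk_left (hg hB)

/-- The fibre measures of `B` integrate to the measure of `C ∩ B` over each set `C` that is trivial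
on almost every fibre: they are a conditional probability of `B`. -/
theorem setLIntegral_slice_measure (α : Measure A) [IsProbabilityMeasure α] (ν : Measure H)
    [IsProbabilityMeasure ν] (μ : Measure X) {g : H × A → X} (hg : Measurable g)
    (hμ : μ = (ν.prod α).map g) {τ : X → H} (hτ : Measurable τ) (hτg : ∀ (h : H) (a : A), τ (g (h, a)) = h)
    {B C : Set X} (hB : MeasurableSet B) (hC : MeasurableSet C)
    (h01 : ∀ᵐ h ∂ν, α {a | g (h, a) ∈ C} = 0 ∨ α {a | g (h, a) ∈ C} = 1) :
    ∫⁻ y in C, α {a | g (τ y, a) ∈ B} ∂μ = μ (C ∩ B) := by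
  have hq := measurable_slice_measure α hg hB
  have hqτ : Measurable fun y => α {a | g (τ y, a) ∈ B} := hq.comp hτ
  rw [hμ, setLIntegral_map hC hqτ hg, Measure.map_apply hg (hC.inter hB),
    Measure.prod_apply (hg (hC.inter hB)), ← lintegral_indicator (hg hC)]
  have hqg : Measurable fun p : H × A => α {a | g (τ (g p), a) ∈ B} := hqτ.comp hg
  rw [lintegral_prod _ (hqg.indicator (hg hC)).aemeasurable]
  refine lintegral_congr_ae (h01.mono fun h hh => ?_)
  have e1 : ∀ a, (g ⁻¹' C).indicator (fun p : H × A => α {a | g (τ (g p), a) ∈ B}) (h, a)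
      = {a | g (h, a) ∈ C}.indicator (fun _ => α {a | g (h, a) ∈ B}) a := by
    intro a
    by_cases hc : g (h, a) ∈ C <;> simp [Set.indicator, hc, hτg]
  have hCs : MeasurableSet {a | g (h, a) ∈ C} := (hg.comp measurable_prodMk_left) hC
  have hBs : MeasurableSet {a | g (h, a) ∈ B} := (hg.comp measurable_prodMk_left) hB
  simp only [e1]
  rw [lintegral_indicator hCs, setLIntegral_const]
  change _ = α ({a | g (h, a) ∈ C} ∩ {a | g (h, a) ∈ B})
  rcases hh with h0 | h1
  · rw [h0, mul_zero, measure_inter_null_of_null_left _ h0]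
  · rw [h1, mul_one]
    rw [Set.inter_comm, measure_inter_conull ((prob_compl_eq_zero_iff hCs).2 h1)]

/-- If `μ` disintegrates over `h` as the laws of `g (h, ·)`, the `σ`-algebra `m` remembers `h`, and
`m`-measurable sets are trivial on almost every fibre, then the relatively independent square of
`μ` over `m` is the law of two points drawn independently from a common random fibre. -/
theorem relIndepSquare_eq_map {A H X : Type*} [MeasurableSpace A] [MeasurableSpace H]
    (m : MeasurableSpace X) [mX : MeasurableSpace X] [StandardBorelSpace X] (α : Measure A)
    [IsProbabilityMeasure α] (ν : Measure H) [IsProbabilityMeasure ν] (μ : ProbabilityMeasure X)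
    (hm : m ≤ mX) {g : H × A → X} (hg : Measurable g)
    (hμ : (μ : Measure X) = (ν.prod α).map g) {τ : X → H} (hτ : Measurable[m] τ)
    (hτg : ∀ (h : H) (a : A), τ (g (h, a)) = h)
    (h01 : ∀ C, MeasurableSet[m] C →
      ∀ᵐ h ∂ν, α {a | g (h, a) ∈ C} = 0 ∨ α {a | g (h, a) ∈ C} = 1) :
    (relIndepSquare m μ hm : Measure (X × X)) =
      (ν.prod (α.prod α)).map fun p => (g (p.1, p.2.1), g (p.1, p.2.2)) := by
  have hτ' : Measurable τ := hτ.mono hm le_rfl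
  have key : ∀ B, MeasurableSet B → ∀ᵐ y ∂(μ : Measure X),
      condExpKernel (μ : Measure X) m y B = α {a | g (τ y, a) ∈ B} := by
    intro B hB
    refine ae_eq_of_ae_eq_trim (hm := hm) ?_
    have hqm : Measurable[m] fun y => α {a | g (τ y, a) ∈ B} :=
      (measurable_slice_measure α hg hB).comp hτ
    refine ae_eq_of_forall_setLIntegral_eq_of_sigmaFinite
      (measurable_condExpKernel hB) hqm fun C hC _ => ?_
    have h1 := congrArg (fun ξ => ξ (C ×ˢ B))
      (compProd_trim_condExpKernel (μ := (μ : Measure X)) hm)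
    rw [Measure.compProd_apply_prod hC hB] at h1
    rw [h1, restrict_trim hm _ hC, lintegral_trim hm hqm,
      setLIntegral_slice_measure α ν (μ : Measure X) hg hμ hτ' hτg hB (hm _ hC) (h01 C hC)]
    rw [Measure.map_apply]
    · rfl
    · exact (measurable_id'' hm).prodMk measurable_id
    · exact hC.prod hB
  have hgg : Measurable fun p : H × A × A => (g (p.1, p.2.1), g (p.1, p.2.2)) := by fun_prop
  refine Measure.ext_prod fun {B C} hB hC => ?_
  rw [Measure.map_apply hgg (hB.prod hC)]
  change ((μ : Measure X).bind _) _ = _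
  rw [Measure.bind_apply (hB.prod hC) (Kernel.measurable _).aemeasurable]
  simp only [Kernel.prod_apply_prod, Kernel.comap_apply, id]
  have e : ∀ᵐ y ∂(μ : Measure X), condExpKernel (μ : Measure X) m y B *
      condExpKernel (μ : Measure X) m y C =
      α {a | g (τ y, a) ∈ B} * α {a | g (τ y, a) ∈ C} := by
    filter_upwards [key B hB, key C hC] with y h1 h2 using by rw [h1, h2]
  have hqq : Measurable fun h => α {a | g (h, a) ∈ B} * α {a | g (h, a) ∈ C} :=
    (measurable_slice_measure α hg hB).mul (measurable_slice_measure α hg hC)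
  have hqτ : Measurable fun y => α {a | g (τ y, a) ∈ B} * α {a | g (τ y, a) ∈ C} := hqq.comp hτ'
  rw [lintegral_congr_ae e, hμ, lintegral_map hqτ hg]
  simp only [hτg]
  have hqf : Measurable fun p : H × A => α {a | g (p.1, a) ∈ B} * α {a | g (p.1, a) ∈ C} :=
    hqq.comp measurable_fst
  rw [lintegral_prod _ hqf.aemeasurable, Measure.prod_apply (hgg (hB.prod hC))]
  refine lintegral_congr fun h => ?_
  simp only [lintegral_const, measure_univ, mul_one]
  rw [← Measure.prod_prod]
  rfl

end RelativeSquare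

/-- For a system fibred over `h` with ergodic fibres, the relatively independent square over the
invariant factor consists of two independent points of a common fibre. -/
theorem relIndepSquare_invariantAlgebra_eq_map {Γ A H X : Type*} [Countable Γ] [MeasurableSpace A]
    [MeasurableSpace H] [MeasurableSpace X] [StandardBorelSpace X] (α : Measure A)
    [IsProbabilityMeasure α] (T : Γ → A → A) (hT : IsErgodicSystem α T) (ν : Measure H)
    [IsProbabilityMeasure ν] (μ : ProbabilityMeasure X) (S : Γ → X → X)
    {g : H × A → X} (hg : Measurable g)
    (hμ : (μ : Measure X) = (ν.prod α).map g) {τ : X → H} (hτ : Measurable τ)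
    (hτg : ∀ (h : H) (a : A), τ (g (h, a)) = h) (hS : ∀ γ h a, S γ (g (h, a)) = g (h, T γ a))
    (hτS : ∀ γ y, τ (S γ y) = τ y) :
    (relIndepSquare (invariantAlgebra (μ : Measure X) S) μ (invariantAlgebra_le _ _) :
      Measure (X × X)) =
      (ν.prod (α.prod α)).map fun p => (g (p.1, p.2.1), g (p.1, p.2.2)) := by
  refine relIndepSquare_eq_map _ α ν μ (invariantAlgebra_le _ _) hg hμ (τ := τ) ?_ hτg ?_
  · intro B hB
    refine ⟨hτ hB, fun γ => Filter.Eventually.of_forall fun y => ?_⟩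
    change (τ (S γ y) ∈ B) = (τ y ∈ B)
    rw [hτS]
  · rintro C ⟨hC, hinv⟩
    have h1 : ∀ γ, ∀ᵐ h ∂ν, ∀ᵐ a ∂α, (g (h, T γ a) ∈ C) = (g (h, a) ∈ C) := by
      intro γ
      have := hinv γ
      rw [hμ] at this
      have := ae_of_ae_map hg.aemeasurable this
      refine (Measure.ae_ae_of_ae_prod this).mono fun h hh => hh.mono fun a ha => ?_
      rw [← hS]
      exact ha
    filter_upwards [ae_all_iff.2 h1] with h hh
    exact hT _ ⟨(hg.comp measurable_prodMk_left) hC, hh⟩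

section Rotations

variable {Γ Z : Type*} [AddCommGroup Γ] [AddCommGroup Z] [TopologicalSpace Z] [CompactSpace Z] [TopologicalSpace.MetrizableSpace Z]
  [MeasurableSpace Z] [BorelSpace Z]

/-- The parallelogram with base point `x` and sides `h`, `k`, as a point of `Z^{{0,1}^2}`. -/
def parallelogram (p : Z × Z × Z) (v : Fin 2 → Bool) : Z :=
  p.1 + (if v 0 then p.2.1 else 0) + (if v 1 then p.2.2 else 0)

/-- The Host--Kra measure of order zero, as a fibred measure over a point. -/
theorem hostKraMeasure_zero_eq_map (μ : ProbabilityMeasure Z) (φ : Γ →+ Z) :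
    (hostKraMeasure μ (rotation φ) 0 : Measure ((Fin 0 → Bool) → Z)) =
      ((Measure.dirac ()).prod (μ : Measure Z)).map fun p _ => p.2 := by
  change (μ : Measure Z).map _ = _
  have hm : Measurable fun (z : Z) (_ : Fin 0 → Bool) => z :=
    measurable_pi_lambda _ fun _ => measurable_id
  have : (fun (p : Unit × Z) (_ : Fin 0 → Bool) => p.2) = (fun z _ => z) ∘ Prod.snd := rfl
  rw [this, ← Measure.map_map hm measurable_snd, Measure.map_snd_prod]
  simp

theorem hostKraMeasure_one_eq_map [Countable Γ] (μ : ProbabilityMeasure Z) (φ : Γ →+ Z)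
    (hφ : IsErgodicSystem (μ : Measure Z) (rotation φ)) :
    (hostKraMeasure μ (rotation φ) 1 : Measure ((Fin 1 → Bool) → Z)) =
      ((μ : Measure Z).prod (μ : Measure Z)).map
        fun (p : Z × Z) (v : Fin 1 → Bool) => if v 0 then p.2 else p.1 := by
  have h := relIndepSquare_invariantAlgebra_eq_map (μ : Measure Z) (rotation φ) hφ
    (Measure.dirac ()) (hostKraMeasure μ (rotation φ) 0) (cubeAction (rotation φ) 0)
    (g := fun p _ => p.2) (measurable_pi_lambda _ fun _ => measurable_snd)
    (hostKraMeasure_zero_eq_map μ φ) (τ := fun _ => ()) measurable_const (fun _ _ => rfl)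
    (fun _ _ _ => rfl) (fun _ _ => rfl)
  refine (congrArg (Measure.map (glueCubes 0)) h).trans ?_
  rw [Measure.map_map (measurable_glueCubes 0) (by fun_prop)]
  have hm : Measurable fun (p : Z × Z) (v : Fin 1 → Bool) => if v 0 then p.2 else p.1 := by
    refine measurable_pi_lambda _ fun v => ?_
    split_ifs <;> fun_prop
  have : (glueCubes 0 ∘ fun p : Unit × Z × Z =>
      ((fun _ => p.2.1, fun _ => p.2.2) : ((Fin 0 → Bool) → Z) × ((Fin 0 → Bool) → Z))) =
      (fun (p : Z × Z) (v : Fin 1 → Bool) => if v 0 then p.2 else p.1) ∘ Prod.snd := rfl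
  rw [this, ← Measure.map_map hm measurable_snd, Measure.map_snd_prod]
  simp

variable [IsTopologicalAddGroup Z]

theorem measurable_parallelogram : Measurable (parallelogram (Z := Z)) := by
  refine measurable_pi_lambda _ fun v => ?_
  unfold parallelogram
  split_ifs <;> fun_prop

/-- Haar measure is preserved by the passage from a pair of points and a side to the base point and
sides of a parallelogram. -/
theorem measurePreserving_parallelogram_sides (m : Measure Z) [IsProbabilityMeasure m]
    [m.IsAddLeftInvariant] :
    MeasurePreserving (fun p : Z × Z × Z => (p.2.1, p.1, p.2.2 - p.2.1))
      (m.prod (m.prod m)) (m.prod (m.prod m)) := by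
  have h1 : MeasurePreserving (fun p : Z × Z => (p.1, -p.1 + p.2)) (m.prod m) (m.prod m) :=
    measurePreserving_prod_neg_add m m
  have h2 := (MeasurePreserving.id m).prod h1
  have h3 := measurePreserving_prodAssoc m m m
  have h4 : MeasurePreserving (Prod.map Prod.swap id : (Z × Z) × Z → (Z × Z) × Z)
      ((m.prod m).prod m) ((m.prod m).prod m) :=
    Measure.measurePreserving_swap.prod (MeasurePreserving.id m)
  have h5 := h3.comp (h4.comp ((h3.symm _).comp h2))
  convert h5 using 1
  funext p
  simp [MeasurableEquiv.prodAssoc, sub_eq_neg_add]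

/-- Haar measure is preserved by the passage from the base point and sides of a parallelogram to a
side and the end points of the other one. -/
theorem measurePreserving_parallelogram_points (m : Measure Z) [IsProbabilityMeasure m]
    [m.IsAddLeftInvariant] :
    MeasurePreserving (fun p : Z × Z × Z => (p.2.1, p.1, p.1 + p.2.2))
      (m.prod (m.prod m)) (m.prod (m.prod m)) := by
  have h1 : MeasurePreserving (fun p : Z × Z => (p.1, p.1 + p.2)) (m.prod m) (m.prod m) :=
    measurePreserving_prod_add m m
  have h2 := (MeasurePreserving.id m).prod h1
  have h3 := measurePreserving_prodAssoc m m m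
  have h4 : MeasurePreserving (Prod.map Prod.swap id : (Z × Z) × Z → (Z × Z) × Z)
      ((m.prod m).prod m) ((m.prod m).prod m) :=
    Measure.measurePreserving_swap.prod (MeasurePreserving.id m)
  exact h2.comp (h3.comp (h4.comp (h3.symm _)))

/-- The Host--Kra measure of order two is the law of a uniformly random parallelogram. -/
theorem hostKraMeasure_two_eq_map [Countable Γ] (μ : ProbabilityMeasure Z) [(μ : Measure Z).IsAddHaarMeasure]
    (φ : Γ →+ Z) (hφ : IsErgodicSystem (μ : Measure Z) (rotation φ)) :
    (hostKraMeasure μ (rotation φ) 2 : Measure ((Fin 2 → Bool) → Z)) =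
      ((μ : Measure Z).prod ((μ : Measure Z).prod (μ : Measure Z))).map parallelogram := by
  set m : Measure Z := (μ : Measure Z)
  have hm1 : Measurable fun (p : Z × Z) (v : Fin 1 → Bool) => if v 0 then p.2 else p.1 := by
    refine measurable_pi_lambda _ fun v => ?_
    split_ifs <;> fun_prop
  have hg : Measurable fun (p : Z × Z) (v : Fin 1 → Bool) => if v 0 then p.2 + p.1 else p.2 := by
    refine measurable_pi_lambda _ fun v => ?_
    split_ifs <;> fun_prop
  -- two independent points are a uniform point and its translate by a uniform step
  have hshear : (hostKraMeasure μ (rotation φ) 1 : Measure ((Fin 1 → Bool) → Z)) = (m.prod m).map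
      fun (p : Z × Z) (v : Fin 1 → Bool) => if v 0 then p.2 + p.1 else p.2 := by
    have hs : MeasurePreserving (fun p : Z × Z => (p.2, p.2 + p.1)) (m.prod m) (m.prod m) :=
      measurePreserving_prod_add_swap m m
    rw [hostKraMeasure_one_eq_map μ φ hφ]
    conv_lhs => rw [← hs.map_eq]
    rw [Measure.map_map hm1 hs.measurable]
    rfl
  have h := relIndepSquare_invariantAlgebra_eq_map m (rotation φ) hφ
    m (hostKraMeasure μ (rotation φ) 1) (cubeAction (rotation φ) 1)
    hg hshear (τ := fun y => y (fun _ => true) - y (fun _ => false)) (by fun_prop)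
    (fun _ _ => by simp) (fun γ h a => by
      funext v
      simp only [cubeAction, rotation]
      split_ifs <;> simp [add_assoc]) (fun γ y => by simp [cubeAction, rotation])
  refine (congrArg (Measure.map (glueCubes 1)) h).trans ?_
  refine (Measure.map_map (measurable_glueCubes 1)
    ((hg.comp (by fun_prop : Measurable fun p : Z × Z × Z => (p.1, p.2.1))).prodMk
      (hg.comp (by fun_prop : Measurable fun p : Z × Z × Z => (p.1, p.2.2))))).trans ?_
  have hs := measurePreserving_parallelogram_sides m
  conv_rhs => rw [← hs.map_eq]
  rw [Measure.map_map measurable_parallelogram hs.measurable]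
  congr 1
  funext p v
  simp only [Function.comp, glueCubes, parallelogram, Fin.init, Fin.last]
  have e1 : v (Fin.castSucc 0) = v 0 := rfl
  have e2 : (⟨1, by omega⟩ : Fin 2) = 1 := rfl
  simp only [e1, e2]
  cases v 0 <;> cases v 1 <;> simp [add_comm]

end Rotations

theorem cubeAction_parallelogram {Γ Z : Type*} [AddCommGroup Γ] [AddCommGroup Z] (φ : Γ →+ Z) (γ : Γ) (x h k : Z) :
    cubeAction (rotation φ) 2 γ (parallelogram (x, h, k)) =
      parallelogram (rotation φ γ x, h, k) := by
  funext v
  simp [cubeAction, rotation, parallelogram, add_assoc]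

theorem cubeDifference_two {Γ Y K : Type*} [AddCommGroup K] (ρ : Γ → Y → K) (γ : Γ)
    (y : (Fin 2 → Bool) → Y) :
    cubeDifference 2 ρ γ y = ρ γ (y ![true, true]) - ρ γ (y ![true, false]) -
      ρ γ (y ![false, true]) + ρ γ (y ![false, false]) := by
  have : (Finset.univ : Finset (Fin 2 → Bool)) =
      {![false, false], ![true, false], ![false, true], ![true, true]} := by decide
  unfold cubeDifference
  rw [this, Finset.sum_insert (by decide), Finset.sum_insert (by decide),
    Finset.sum_insert (by decide), Finset.sum_singleton]
  simp [Fin.sum_univ_two]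
  abel

open Filter Topology Set
open scoped ContDiff Manifold Pointwise

/-! ### Measurable selection -/

section Selection

/-- An open set of sequences containing the compact box `∏ i, [0, b i]` already contains a
finite-stage box. -/
theorem exists_initial_box_subset {b : ℕ → ℕ} {O : Set (ℕ → ℕ)} (hO : IsOpen O)
    (hb : {x | ∀ i, x i ≤ b i} ⊆ O) : ∃ j, {x : ℕ → ℕ | ∀ i < j, x i ≤ b i} ⊆ O := by
  by_contra! h
  choose y hy hyO using fun j => not_subset.1 (h j)
  have hcomp : IsCompact {x : ℕ → ℕ | ∀ i, x i ≤ b i} := by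
    have : {x : ℕ → ℕ | ∀ i, x i ≤ b i} = Set.pi univ fun i => Iic (b i) := by ext; simp [Pi.le_def]
    rw [this]
    exact isCompact_univ_pi fun i => (finite_Iic (b i)).isCompact
  let y' : ℕ → ℕ → ℕ := fun j i => if i < j then y j i else 0
  have hy' : ∀ j, y' j ∈ {x : ℕ → ℕ | ∀ i, x i ≤ b i} := by
    intro j i
    by_cases hij : i < j
    · simpa [y', hij] using hy j i hij
    · simp [y', hij]
  obtain ⟨x, hx, u, hu, hlim⟩ := hcomp.tendsto_subseq hy'
  have hlim' : Tendsto (y ∘ u) atTop (𝓝 x) := by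
    rw [tendsto_pi_nhds] at hlim ⊢
    intro i
    refine (hlim i).congr' ?_
    filter_upwards [eventually_gt_atTop i] with k hk
    have : i < u k := hk.trans_le (hu.id_le k)
    simp [y', this]
  obtain ⟨k, hk⟩ := (hlim'.eventually (hO.mem_nhds (hb hx))).exists
  exact hyO _ hk

/-- Analytic sets are approximated from inside by compact sets. -/
theorem exists_isCompact_measure_image_le {Z : Type*} [TopologicalSpace Z] [MeasurableSpace Z]
    (μ : Measure Z) [IsFiniteMeasure μ] [μ.OuterRegular] {f : (ℕ → ℕ) → Z}
    (hf : Continuous f) {ε : ENNReal} (hε : ε ≠ 0) :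
    ∃ C ⊆ range f, IsCompact C ∧ μ (range f) ≤ μ C + ε := by
  obtain ⟨δ, hδ, hδε⟩ := ENNReal.exists_pos_sum_of_countable (ENNReal.half_pos hε).ne' ℕ
  have step : ∀ (C : Set (ℕ → ℕ)) (j : ℕ), ∃ n : ℕ,
      μ (f '' C) ≤ μ (f '' (C ∩ {x | x j ≤ n})) + δ j := by
    intro C j
    have hmono : Monotone fun n : ℕ => f '' (C ∩ {x | x j ≤ n}) := fun a b hab =>
      image_mono (inter_subset_inter_right _ fun x (hx : x j ≤ a) => hx.trans hab)
    have hU : ⋃ n : ℕ, f '' (C ∩ {x | x j ≤ n}) = f '' C := by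
      rw [← image_iUnion, ← inter_iUnion]
      congr 1
      refine inter_eq_left.2 fun x _ => mem_iUnion.2 ⟨x j, le_refl (x j)⟩
    have ht := tendsto_measure_iUnion_atTop (μ := μ) hmono
    rw [hU] at ht
    have hpos : (δ j : ENNReal) ≠ 0 := by exact_mod_cast (hδ j).ne'
    obtain ⟨n, hn⟩ := (((ENNReal.tendsto_nhds (measure_ne_top _ _)).1 ht) (δ j)
      (pos_iff_ne_zero.2 hpos)).exists
    exact ⟨n, tsub_le_iff_right.1 hn.1⟩
  choose n hn using step
  let C : ℕ → Set (ℕ → ℕ) := fun j => Nat.rec univ (fun j C => C ∩ {x | x j ≤ n C j}) j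
  let b : ℕ → ℕ := fun j => n (C j) j
  have hC : ∀ j, C j = {x | ∀ i < j, x i ≤ b i} := by
    intro j
    induction j with
    | zero => ext; simp [C]
    | succ j ih =>
      have : C (j + 1) = C j ∩ {x | x j ≤ b j} := rfl
      rw [this, ih]
      ext x
      simp only [mem_inter_iff, mem_ofPred_eq]
      exact Nat.forall_lt_succ_right.symm
  have hCm : ∀ j, μ (range f) ≤ μ (f '' C j) + ∑ i ∈ Finset.range j, (δ i : ENNReal) := by
    intro j
    induction j with
    | zero => simp [C]
    | succ j ih =>
      refine ih.trans ?_
      rw [Finset.sum_range_succ, add_comm _ (δ j : ENNReal), ← add_assoc]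
      gcongr
      exact hn (C j) j
  have hB : IsCompact {x : ℕ → ℕ | ∀ i, x i ≤ b i} := by
    have : {x : ℕ → ℕ | ∀ i, x i ≤ b i} = Set.pi univ fun i => Iic (b i) := by ext; simp [Pi.le_def]
    rw [this]
    exact isCompact_univ_pi fun i => (finite_Iic (b i)).isCompact
  refine ⟨f '' {x : ℕ → ℕ | ∀ i, x i ≤ b i}, image_subset_range _ _, hB.image hf, ?_⟩
  obtain ⟨W, hW, hWo, hWμ⟩ := (f '' {x : ℕ → ℕ | ∀ i, x i ≤ b i}).exists_isOpen_le_add μ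
    (ENNReal.half_pos hε).ne'
  obtain ⟨j, hj⟩ := exists_initial_box_subset (hWo.preimage hf) (image_subset_iff.1 hW)
  have h1 : μ (f '' C j) ≤ μ W := measure_mono (by rw [hC]; exact image_subset_iff.2 hj)
  calc μ (range f) ≤ μ (f '' C j) + ∑ i ∈ Finset.range j, (δ i : ENNReal) := hCm j
    _ ≤ (μ (f '' {x : ℕ → ℕ | ∀ i, x i ≤ b i}) + ε / 2) + ε / 2 := by
      gcongr
      · exact h1.trans hWμ
      · exact (ENNReal.sum_le_tsum _).trans hδε.le
    _ = _ := by rw [add_assoc, ENNReal.add_halves]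

/-- Analytic sets are measurable with respect to every finite Borel measure. -/
theorem nullMeasurableSet_of_analyticSet {Z : Type*} [TopologicalSpace Z] [T2Space Z]
    [MeasurableSpace Z] [BorelSpace Z] (μ : Measure Z) [IsFiniteMeasure μ] [μ.OuterRegular]
    {s : Set Z} (hs : AnalyticSet s) : NullMeasurableSet s μ := by
  rw [AnalyticSet] at hs
  rcases hs with rfl | ⟨f, hf, rfl⟩
  · exact nullMeasurableSet_empty
  choose C hCs hC hCμ using fun n : ℕ => exists_isCompact_measure_image_le μ hf
    (ε := ((n : ENNReal) + 1)⁻¹) (by simp)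
  have hT : MeasurableSet (⋃ n, C n) := .iUnion fun n => (hC n).measurableSet
  refine hT.nullMeasurableSet.congr
    (ae_eq_of_subset_of_measure_ge (iUnion_subset hCs) ?_ hT.nullMeasurableSet (by finiteness))
  refine ENNReal.le_of_forall_pos_le_add fun ε hε _ => ?_
  obtain ⟨n, hn⟩ := ENNReal.exists_inv_nat_lt (a := (ε : ENNReal)) (by exact_mod_cast hε.ne')
  refine (hCμ n).trans (add_le_add (measure_mono (subset_iUnion _ _)) ?_)
  exact (ENNReal.inv_le_inv.2 le_self_add).trans hn.le

/-- The cylinder of all sequences that start with the list `l`. -/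
def listCylinder (l : List ℕ) : Set (ℕ → ℕ) := {x | (List.range l.length).map x = l}

theorem isOpen_listCylinder (l : List ℕ) : IsOpen (listCylinder l) := by
  have : Continuous fun x : ℕ → ℕ => fun i : Fin l.length => x i := by fun_prop
  have h : listCylinder l = (fun x : ℕ → ℕ => fun i : Fin l.length => x i) ⁻¹'
      {fun i => l[i]} := by
    ext x
    simp only [listCylinder, mem_ofPred_eq, mem_preimage, mem_singleton_iff, funext_iff]
    constructor
    · intro h i
      have := congrArg (fun l' => l'[(i : ℕ)]?) h
      simpa using this
    · intro h
      refine List.ext_getElem (by simp) fun i h1 h2 => ?_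
      simpa using h ⟨i, h2⟩
  rw [h]
  exact (isOpen_discrete _).preimage this

/-- Von Neumann's selection: a continuous surjection from Baire space has an almost everywhere
defined measurable section, obtained by always following the first possible branch. -/
theorem exists_aemeasurable_section {Z : Type*} [TopologicalSpace Z] [T2Space Z]
    [MeasurableSpace Z] [BorelSpace Z] (μ : Measure Z) [IsFiniteMeasure μ] [μ.OuterRegular]
    {f : (ℕ → ℕ) → Z} (hf : Continuous f) (hsurj : Function.Surjective f) :
    ∃ s : Z → ℕ → ℕ, AEMeasurable s μ ∧ ∀ z, f (s z) = z := by
  let D : List ℕ → Set Z := fun l => f '' listCylinder l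
  have hD : ∀ l, NullMeasurableSet (D l) μ := fun l =>
    nullMeasurableSet_of_analyticSet μ ((isOpen_listCylinder l).analyticSet_image hf)
  have hext : ∀ l z, z ∈ D l → ∃ k, z ∈ D (l ++ [k]) := by
    rintro l _ ⟨x, hx, rfl⟩
    refine ⟨x l.length, x, ?_, rfl⟩
    have hx' : (List.range l.length).map x = l := hx
    simp [listCylinder, List.range_succ, hx']
  let next : Z → List ℕ → ℕ := fun z l => sInf {k | z ∈ D (l ++ [k])}
  let P : Z → ℕ → List ℕ := fun z n => Nat.rec [] (fun _ l => l ++ [next z l]) n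
  let s : Z → ℕ → ℕ := fun z n => next z (P z n)
  have hPs : ∀ z n, P z n = (List.range n).map (s z) := by
    intro z n
    induction n with
    | zero => rfl
    | succ n ih =>
      rw [List.range_succ, List.map_append, ← ih]
      rfl
  have hPD : ∀ z n, z ∈ D (P z n) := by
    intro z n
    induction n with
    | zero =>
      obtain ⟨x, rfl⟩ := hsurj z
      exact ⟨x, by simp [listCylinder, P], rfl⟩
    | succ n ih => exact Nat.sInf_mem (hext _ _ ih)
  have hE : ∀ n l, NullMeasurableSet {z | P z n = l} μ := by
    intro n
    induction n with
    | zero => exact fun l => NullMeasurableSet.const (([] : List ℕ) = l)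
    | succ n ih =>
      intro l
      rcases List.eq_nil_or_concat l with rfl | ⟨l, k, rfl⟩
      · have : {z | P z (n + 1) = []} = ∅ := by ext z; simp [P]
        rw [this]
        exact nullMeasurableSet_empty
      · have : {z | P z (n + 1) = l ++ [k]} =
            {z | P z n = l} ∩ (D (l ++ [k]) ∩ ⋂ j : Fin k, (D (l ++ [(j : ℕ)]))ᶜ) := by
          ext z
          have e : P z (n + 1) = P z n ++ [next z (P z n)] := rfl
          simp only [mem_ofPred_eq, e, mem_inter_iff, mem_iInter, mem_compl_iff]
          constructor
          · intro h
            obtain ⟨h1, h2⟩ := List.append_inj' h rfl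
            have h2 : next z (P z n) = k := by simpa using h2
            have hz := hPD z (n + 1)
            rw [e, h1] at hz
            rw [h1] at h2
            rw [h2] at hz
            refine ⟨h1, hz, fun j hj => ?_⟩
            have : next z l ≤ j := Nat.sInf_le hj
            have := j.2
            omega
          · rintro ⟨h1, h2, h3⟩
            rw [h1]
            congr 2
            refine le_antisymm (Nat.sInf_le h2) (le_csInf ⟨k, h2⟩ fun j hj => ?_)
            by_contra! hjk
            exact h3 ⟨j, hjk⟩ hj
        rw [List.concat_eq_append, this]
        exact (ih l).inter ((hD _).inter (.iInter fun j => (hD _).compl))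
  refine ⟨s, ?_, fun z => ?_⟩
  · refine aemeasurable_pi_iff.2 fun n => ?_
    have hs : ∀ k, NullMeasurableSet ((fun z => s z n) ⁻¹' {k}) μ := by
      intro k
      have : (fun z => s z n) ⁻¹' {k} = ⋃ l, {z | P z (n + 1) = l ++ [k]} := by
        ext z
        have e : P z (n + 1) = P z n ++ [s z n] := rfl
        simp only [mem_preimage, mem_singleton_iff, mem_iUnion, mem_ofPred_eq, e]
        constructor
        · rintro rfl
          exact ⟨_, rfl⟩
        · rintro ⟨l, hl⟩
          simpa using (List.append_inj' hl rfl).2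
      rw [this]
      exact .iUnion fun l => hE (n + 1) (l ++ [k])
    have hnm : NullMeasurable (fun z => s z n) μ := by
      intro A _
      rw [← biUnion_preimage_singleton]
      exact .biUnion (to_countable A) fun k _ => hs k
    exact hnm.aemeasurable
  · choose x hx hxz using fun n => hPD z n
    have hlim : Tendsto x atTop (𝓝 (s z)) := by
      rw [tendsto_pi_nhds]
      intro i
      refine tendsto_const_nhds.congr' ?_
      filter_upwards [eventually_gt_atTop i] with n hn
      have h := hx n
      rw [hPs] at h
      simp only [listCylinder, List.length_map, List.length_range, mem_ofPred_eq] at h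
      have := congrArg (fun l' => l'[i]?) h
      simpa [hn] using this.symm
    exact tendsto_nhds_unique ((hf.tendsto _).comp hlim)
      (tendsto_const_nhds.congr fun n => (hxz n).symm)

/-- Measurable uniformization: a Borel relation with full domain contains the graph of a measurable
function, up to a null set of the domain. -/
theorem exists_measurable_uniformization {Z Y : Type*} [TopologicalSpace Z] [PolishSpace Z]
    [MeasurableSpace Z] [BorelSpace Z] (μ : Measure Z) [IsFiniteMeasure μ] [μ.OuterRegular]
    [MeasurableSpace Y] [StandardBorelSpace Y]
    {P : Set (Z × Y)} (hP : MeasurableSet P) (hdom : ∀ z, ∃ y, (z, y) ∈ P) :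
    ∃ s : Z → Y, Measurable s ∧ ∀ᵐ z ∂μ, (z, s z) ∈ P := by
  rcases isEmpty_or_nonempty Z with hZ | ⟨⟨z₀⟩⟩
  · exact ⟨fun z => (hZ.false z).elim, measurable_of_empty _, .of_forall fun z => (hZ.false z).elim⟩
  let _ := upgradeStandardBorel Y
  have hPa := hP.analyticSet
  rw [AnalyticSet] at hPa
  rcases hPa with rfl | ⟨g, hg, rfl⟩
  · obtain ⟨y, hy⟩ := hdom z₀
    exact hy.elim
  obtain ⟨s, hs, hsec⟩ := exists_aemeasurable_section μ (f := fun x => (g x).1) (by fun_prop)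
    fun z => by
      obtain ⟨y, x, hx⟩ := hdom z
      exact ⟨x, congrArg Prod.fst hx⟩
  refine ⟨fun z => (g (hs.mk s z)).2, measurable_snd.comp (hg.measurable.comp hs.measurable_mk), ?_⟩
  filter_upwards [hs.ae_eq_mk] with z hz
  refine ⟨hs.mk s z, Prod.ext ?_ rfl⟩
  rw [← hz]
  exact hsec z

/-- Up to null sets, all measurable maps `Z → K` occur among the sections of a single jointly
measurable map with parameters in a Polish space. -/
theorem exists_universal_measurable (Z K : Type*) [TopologicalSpace Z] [SecondCountableTopology Z]
    [MeasurableSpace Z] [BorelSpace Z] (μ : Measure Z) [IsFiniteMeasure μ] [μ.OuterRegular]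
    [MeasurableSpace K] [StandardBorelSpace K] [Nonempty K] :
    ∃ Φ : (ℕ → ℕ → ℕ → ℕ) × Z → K, Measurable Φ ∧
      ∀ F : Z → K, Measurable F → ∃ y, ∀ᵐ z ∂μ, F z = Φ (y, z) := by
  obtain ⟨B, hBr⟩ := ((TopologicalSpace.countable_countableBasis Z).insert ∅).exists_eq_range
    (insert_nonempty _ _)
  have hBo : ∀ j, IsOpen (B j) := by
    intro j
    have : B j ∈ insert ∅ (TopologicalSpace.countableBasis Z) := hBr ▸ mem_range_self j
    rcases this with h | h
    · rw [h]; exact isOpen_empty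
    · exact TopologicalSpace.isOpen_of_mem_countableBasis h
  have hcover : ∀ O : Set Z, IsOpen O → ∃ e : ℕ → ℕ, O = ⋃ j, B (e j) := by
    intro O hO
    obtain ⟨e, he⟩ : ∃ e : ℕ → ℕ, {j | B j ⊆ O} = range e := by
      refine (to_countable {j | B j ⊆ O}).exists_eq_range ?_
      have : (∅ : Set Z) ∈ range B := hBr ▸ mem_insert _ _
      obtain ⟨j, hj⟩ := this
      exact ⟨j, by simp [hj]⟩
    refine ⟨e, Subset.antisymm (fun z hz => ?_) (iUnion_subset fun j => ?_)⟩
    · obtain ⟨b, hb, hzb, hbO⟩ :=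
        (TopologicalSpace.isBasis_countableBasis Z).exists_subset_of_mem_open hz hO
      have : b ∈ range B := hBr ▸ mem_insert_of_mem _ hb
      obtain ⟨j, rfl⟩ := this
      have hj : j ∈ range e := he ▸ hbO
      obtain ⟨i, rfl⟩ := hj
      exact mem_iUnion.2 ⟨i, hzb⟩
    · have : e j ∈ {j | B j ⊆ O} := he ▸ mem_range_self j
      exact this
  have hset : ∀ A : Set Z, MeasurableSet A → ∃ y : ℕ → ℕ → ℕ,
      A =ᵐ[μ] ⋂ i, ⋃ j, B (y i j) := by
    intro A hA
    choose O hAO hO hOμ using fun n : ℕ => A.exists_isOpen_le_add μ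
      (ε := ((n : ENNReal) + 1)⁻¹) (by simp)
    choose y hy using fun n => hcover (O n) (hO n)
    refine ⟨y, ae_eq_of_subset_of_measure_ge (subset_iInter fun i => (hy i) ▸ hAO i) ?_
      hA.nullMeasurableSet (by finiteness)⟩
    refine ENNReal.le_of_forall_pos_le_add fun ε hε _ => ?_
    obtain ⟨n, hn⟩ := ENNReal.exists_inv_nat_lt (a := (ε : ENNReal)) (by exact_mod_cast hε.ne')
    calc μ (⋂ i, ⋃ j, B (y i j)) ≤ μ (O n) := measure_mono ((iInter_subset _ n).trans (hy n).ge)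
      _ ≤ μ A + ((n : ENNReal) + 1)⁻¹ := hOμ n
      _ ≤ μ A + ε := by
        gcongr
        exact (ENNReal.inv_le_inv.2 le_self_add).trans hn.le
  obtain ⟨c, hc, hcinj⟩ := MeasurableSpace.measurable_injection_nat_bool_of_countablySeparated K
  have hce : MeasurableEmbedding c := hc.measurableEmbedding hcinj
  obtain ⟨d, hd, hdc⟩ := hce.exists_measurable_extend (g := id) measurable_id fun _ => inferInstance
  let W : ℕ → Set ((ℕ → ℕ → ℕ → ℕ) × Z) := fun n => ⋂ i, ⋃ j, {p | p.2 ∈ B (p.1 n i j)}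
  have hW : ∀ n, MeasurableSet (W n) := by
    intro n
    refine .iInter fun i => .iUnion fun j => ?_
    have : {p : (ℕ → ℕ → ℕ → ℕ) × Z | p.2 ∈ B (p.1 n i j)} =
        ⋃ k, {p | p.1 n i j = k} ∩ {p | p.2 ∈ B k} := by ext; simp
    rw [this]
    refine .iUnion fun k => .inter ?_ (measurable_snd (hBo k).measurableSet)
    have : Measurable fun p : (ℕ → ℕ → ℕ → ℕ) × Z => p.1 n i j := by fun_prop
    exact this (measurableSet_singleton k)
  classical
  refine ⟨fun p => d fun n => decide (p ∈ W n), hd.comp (measurable_pi_lambda _ fun n =>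
    measurable_to_bool (by
      convert hW n
      ext p
      simp)), fun F hF => ?_⟩
  have hA : ∀ n, MeasurableSet {z | c (F z) n = true} := fun n =>
    ((measurable_pi_apply n).comp (hc.comp hF)) (measurableSet_singleton true)
  choose y hy using fun n => hset _ (hA n)
  refine ⟨y, ?_⟩
  filter_upwards [ae_all_iff.2 fun n => (hy n).mem_iff] with z hz
  have : (fun n => decide ((y, z) ∈ W n)) = c (F z) := by
    funext n
    have h1 : (y, z) ∈ W n ↔ c (F z) n = true := by
      rw [show c (F z) n = true ↔ _ from hz n]
      simp [W]
    cases hcn : c (F z) n <;> simp [h1, hcn]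
  rw [this]
  exact (congrFun hdc (F z)).symm

end Selection

/-! ### From the Conze--Lesigne equation to type two -/

theorem measurableSet_setOf_forall_ae {ι W X K : Type*} [Countable ι] [MeasurableSpace W]
    [MeasurableSpace X] (ν : Measure X) [SFinite ν] [MeasurableSpace K] [MeasurableEq K]
    {a b : ι → W × X → K} (ha : ∀ i, Measurable (a i)) (hb : ∀ i, Measurable (b i)) :
    MeasurableSet {w | ∀ i, ∀ᵐ x ∂ν, a i (w, x) = b i (w, x)} := by
  simp only [Set.ofPred_forall]
  refine .iInter fun i => ?_
  exact measurable_measure_prodMk_left (measurableSet_eq_fun (ha i) (hb i)).compl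
    (measurableSet_singleton 0)

section

variable {Γ Z K : Type*} [AddCommGroup Γ] [AddCommGroup Z] [TopologicalSpace Z]
  [IsTopologicalAddGroup Z] [MeasurableSpace Z] [BorelSpace Z]

theorem measurable_rotation (φ : Γ →+ Z) (γ : Γ) : Measurable (rotation φ γ) :=
  measurable_const_add (φ γ)

theorem measurePreserving_rotation (μ : Measure Z) [μ.IsAddLeftInvariant] (φ : Γ →+ Z) (γ : Γ) :
    MeasurePreserving (rotation φ γ) μ μ :=
  measurePreserving_add_left μ (φ γ)

variable [Countable Γ] [CompactSpace Z] [TopologicalSpace.MetrizableSpace Z]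
  [AddCommGroup K] [MeasurableSpace K]

/-- A measurable choice of the primitives in the Conze--Lesigne equation, for almost every
translation; the constants are eliminated by comparing two points. -/
theorem ObeysConzeLesigne.exists_measurable_primitive [StandardBorelSpace K] [MeasurableAdd₂ K]
    [MeasurableSub₂ K]
    (μ : Measure Z) [IsProbabilityMeasure μ] [μ.IsAddLeftInvariant] (φ : Γ →+ Z) {ρ : Γ → Z → K}
    (hρ : ∀ γ, Measurable (ρ γ)) (h : ObeysConzeLesigne μ φ ρ) :
    ∃ F : Z × Z → K, Measurable F ∧ ∀ᵐ t ∂μ, ∀ γ, ∀ᵐ p ∂(μ.prod μ),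
      (ρ γ (t + p.2) - ρ γ p.2) - (ρ γ (t + p.1) - ρ γ p.1) =
        (F (t, rotation φ γ p.2) - F (t, p.2)) - (F (t, rotation φ γ p.1) - F (t, p.1)) := by
  obtain ⟨Φ, hΦ, huniv⟩ := exists_universal_measurable Z K μ
  let Y := ℕ → ℕ → ℕ → ℕ
  have hS := measurable_rotation φ
  let a : Γ → (Z × Y) × (Z × Z) → K := fun γ q =>
    (ρ γ (q.1.1 + q.2.2) - ρ γ q.2.2) - (ρ γ (q.1.1 + q.2.1) - ρ γ q.2.1)
  let b : Γ → (Z × Y) × (Z × Z) → K := fun γ q =>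
    (Φ (q.1.2, rotation φ γ q.2.2) - Φ (q.1.2, q.2.2)) -
      (Φ (q.1.2, rotation φ γ q.2.1) - Φ (q.1.2, q.2.1))
  have ha : ∀ γ, Measurable (a γ) := fun γ => by
    have := hρ γ
    fun_prop
  have hb : ∀ γ, Measurable (b γ) := fun γ => by
    have := hS γ
    fun_prop
  have hP := measurableSet_setOf_forall_ae (μ.prod μ) ha hb
  obtain ⟨s, hs, hsP⟩ := exists_measurable_uniformization μ hP
    (fun t => by
      obtain ⟨F, hF, c, hc⟩ := h t
      obtain ⟨y, hy⟩ := huniv F hF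
      refine ⟨y, fun γ => ?_⟩
      have h1 : ∀ᵐ x ∂μ, ρ γ (t + x) - ρ γ x = Φ (y, rotation φ γ x) - Φ (y, x) + c γ := by
        filter_upwards [hc γ, hy,
          (measurePreserving_rotation μ φ γ).quasiMeasurePreserving.ae hy] with x h1 h2 h3
        rw [← h2, ← h3, ← h1]
        rfl
      filter_upwards [Measure.quasiMeasurePreserving_fst.ae h1,
        Measure.quasiMeasurePreserving_snd.ae h1] with p h2 h3
      simp only [a, b]
      rw [h2, h3]
      abel)
  refine ⟨fun p => Φ (s p.1, p.2), by fun_prop, hsP⟩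

/-- With `F (t, ·)` solving the Conze--Lesigne equation at `t`, the function
`F (t, x + k) - F (t, x)` of the parallelogram with base `x` and sides `t`, `k` is a primitive of the
second difference. -/
theorem ObeysConzeLesigne.isOfType_two [StandardBorelSpace K] [MeasurableAdd₂ K]
    [MeasurableSub₂ K] (μ : ProbabilityMeasure Z) [(μ : Measure Z).IsAddHaarMeasure] (φ : Γ →+ Z)
    (hφ : IsErgodicSystem (μ : Measure Z) (rotation φ)) {ρ : Γ → Z → K}
    (hρ : ∀ γ, Measurable (ρ γ)) (h : ObeysConzeLesigne (μ : Measure Z) φ ρ) :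
    IsOfType μ (rotation φ) 2 ρ := by
  set m : Measure Z := (μ : Measure Z)
  obtain ⟨F, hF, hFeq⟩ := h.exists_measurable_primitive m φ hρ
  let G : ((Fin 2 → Bool) → Z) → K := fun y =>
    F (y ![true, false] - y ![false, false], y ![false, true]) -
      F (y ![true, false] - y ![false, false], y ![false, false])
  have hG : Measurable G := by fun_prop
  refine ⟨G, hG, fun γ => ?_⟩
  rw [hostKraMeasure_two_eq_map μ φ hφ]
  have hSγ := measurable_rotation φ γ
  have hS2 : Measurable (cubeAction (rotation φ) 2 γ) :=
    measurable_pi_lambda _ fun v => hSγ.comp (measurable_pi_apply v)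
  have hdiff : Measurable (cubeDifference 2 ρ γ) := by
    have e : cubeDifference 2 ρ γ = _ := funext (cubeDifference_two ρ γ)
    rw [e]
    have := hρ γ
    fun_prop
  have hGS : Measurable fun y => G (cubeAction (rotation φ) 2 γ y) - G y :=
    (hG.comp hS2).sub hG
  rw [ae_map_iff measurable_parallelogram.aemeasurable (measurableSet_eq_fun hdiff hGS)]
  have hmp := measurePreserving_parallelogram_points m
  have hprod : ∀ᵐ q ∂m.prod (m.prod m),
      (ρ γ (q.1 + q.2.2) - ρ γ q.2.2) - (ρ γ (q.1 + q.2.1) - ρ γ q.2.1) =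
        (F (q.1, rotation φ γ q.2.2) - F (q.1, q.2.2)) -
          (F (q.1, rotation φ γ q.2.1) - F (q.1, q.2.1)) := by
    rw [Measure.ae_prod_iff_ae_ae]
    · exact hFeq.mono fun t ht => ht γ
    · have := hρ γ
      exact measurableSet_eq_fun (by fun_prop) (by fun_prop)
  filter_upwards [hmp.quasiMeasurePreserving.ae hprod] with p hp
  obtain ⟨x, t, k⟩ := p
  simp only at hp
  rw [cubeDifference_two, cubeAction_parallelogram]
  simp only [G, parallelogram]
  simp only [Matrix.cons_val_zero, Matrix.cons_val_one, if_true, Bool.false_eq_true, if_false,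
    add_zero, add_sub_cancel_left]
  have e1 : t + (x + k) = x + t + k := by abel
  have e2 : t + x = x + t := by abel
  have e3 : rotation φ γ (x + k) = rotation φ γ x + k := by simp [rotation, add_assoc]
  rw [e1, e2, e3] at hp
  calc _ = ρ γ (x + t + k) - ρ γ (x + k) - (ρ γ (x + t) - ρ γ x) := by abel
    _ = _ := hp
    _ = _ := by abel

end

/-! ### Approximate logarithms of Lie groups -/

/-- An approximate logarithm near the origin of a topological abelian group `K`: a chart `log` with
values in a normed space, for which addition and subtraction of small elements agree with those of
the vector space up to a relative error of `1 / 100` of the second argument. `size` is the norm of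
`log` near the origin, and is large far away from it; `exp` is a local right inverse of `log`. -/
structure ApproxLog (K E : Type*) [AddCommGroup K] [TopologicalSpace K] [MeasurableSpace K]
    [NormedAddCommGroup E] [MeasurableSpace E] where
  size : K → ℝ
  log : K → E
  exp : E → K
  radius : ℝ
  radius_pos : 0 < radius
  measurable_size : Measurable size
  measurable_log : Measurable log
  measurable_exp : Measurable exp
  hasBasis_nhds : (𝓝 (0 : K)).HasBasis (fun s : ℝ => 0 < s) (fun s => {a | size a ≤ s})
  norm_log : ∀ a, size a ≤ radius → ‖log a‖ = size a
  log_exp : ∀ v, ‖v‖ ≤ radius → log (exp v) = v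
  size_exp : ∀ v, ‖v‖ ≤ radius → size (exp v) = ‖v‖
  size_add : ∀ a b, size a ≤ radius → size b ≤ radius → size (a + b) = ‖log (a + b)‖
  size_sub : ∀ a b, size a ≤ radius → size b ≤ radius → size (a - b) = ‖log (a - b)‖
  log_add : ∀ a b, size a ≤ radius → size b ≤ radius →
    ‖log (a + b) - log a - log b‖ ≤ 1 / 100 * size b
  log_sub : ∀ a b, size a ≤ radius → size b ≤ radius →
    ‖log (a - b) - log a + log b‖ ≤ 1 / 100 * size b

section Chart

variable {E : Type*} [NormedAddCommGroup E] [NormedSpace ℝ E]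
  {K : Type*} [AddCommGroup K] [TopologicalSpace K]

/-- Near the origin, a group operation `m` read in the chart `e` is close to its derivative
`(v, w) ↦ v + c • w`, with an error controlled by the second argument alone. -/
theorem exists_chart_op_estimate (e : OpenPartialHomeomorph K E) (h0 : (0 : K) ∈ e.source)
    (m : K → K → K) (hm0 : ∀ a, m a 0 = a) (hm : ContinuousAt (fun p : K × K => m p.1 p.2) (0, 0))
    (c : ℝ) {L : E × E →L[ℝ] E}
    (hL : HasStrictFDerivAt (fun p : E × E => e (m (e.symm p.1) (e.symm p.2))) L (e 0, e 0))
    (hc : ∀ w, L (0, w) = c • w) :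
    ∃ r > 0, ∀ a ∈ e.source, ∀ b ∈ e.source, ‖e a - e 0‖ ≤ r → ‖e b - e 0‖ ≤ r →
      m a b ∈ e.source ∧ ‖(e (m a b) - e 0) - (e a - e 0) - c • (e b - e 0)‖ ≤
        1 / 100 * ‖e b - e 0‖ := by
  set v₀ := e 0 with hv₀
  have hsymm : e.symm v₀ = 0 := e.left_inv h0
  have htgt : v₀ ∈ e.target := e.map_source h0
  have hcsymm : ContinuousAt e.symm v₀ := e.continuousAt_symm htgt
  have hm00 : m 0 0 = 0 := hm0 0
  -- the derivative in the first variable is the identity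
  have hL1 : ∀ v, L (v, 0) = v := by
    have h1 : HasFDerivAt (fun v : E => e (m (e.symm v) (e.symm v₀)))
        (L.comp (ContinuousLinearMap.inl ℝ E E)) v₀ :=
      hL.hasFDerivAt.comp (f := fun v : E => (v, v₀)) v₀ (hasFDerivAt_prodMk_left v₀ v₀)
    have h2 : HasFDerivAt (fun v : E => e (m (e.symm v) (e.symm v₀)))
        (ContinuousLinearMap.id ℝ E) v₀ := by
      refine (hasFDerivAt_id v₀).congr_of_eventuallyEq ?_
      filter_upwards [e.open_target.mem_nhds htgt] with v hv
      simp [hsymm, hm0, e.right_inv hv]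
    intro v
    have := congrArg (fun T : E →L[ℝ] E => T v) (h1.unique h2)
    simpa using this
  have hlin : ∀ v w, L (v, w) = v + c • w := by
    intro v w
    have : ((v, w) : E × E) = (v, 0) + (0, w) := by simp
    rw [this, map_add, hL1, hc]
  have hest := hL.isLittleO.def (show (0 : ℝ) < 1 / 100 by norm_num)
  have hsrc : ∀ᶠ p : E × E in 𝓝 (v₀, v₀), m (e.symm p.1) (e.symm p.2) ∈ e.source := by
    have hcont : ContinuousAt (fun p : E × E => m (e.symm p.1) (e.symm p.2)) (v₀, v₀) := by
      refine ContinuousAt.comp (g := fun p : K × K => m p.1 p.2)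
        (f := fun p : E × E => (e.symm p.1, e.symm p.2)) ?_ ?_
      · simpa only [hsymm] using hm
      · exact (hcsymm.comp (f := Prod.fst) (x := (v₀, v₀)) continuousAt_fst).prodMk
          (hcsymm.comp (f := Prod.snd) (x := (v₀, v₀)) continuousAt_snd)
    refine hcont.eventually (e.open_source.mem_nhds ?_)
    simpa [hsymm, hm00] using h0
  obtain ⟨δ₁, hδ₁, hb₁⟩ := Metric.eventually_nhds_iff.1 hest
  obtain ⟨δ₂, hδ₂, hb₂⟩ := Metric.eventually_nhds_iff.1 hsrc
  refine ⟨min δ₁ δ₂ / 2, by positivity, fun a ha b hb har hbr => ?_⟩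
  have hlt : min δ₁ δ₂ / 2 < min δ₁ δ₂ := half_lt_self (by positivity)
  have hda : dist (e a) v₀ < min δ₁ δ₂ := by rw [dist_eq_norm]; exact har.trans_lt hlt
  have hdb : dist (e b) v₀ < min δ₁ δ₂ := by rw [dist_eq_norm]; exact hbr.trans_lt hlt
  constructor
  · have := hb₂ (y := (e a, e b)) (by
      rw [Prod.dist_eq]
      exact max_lt (hda.trans_le (min_le_right _ _)) (hdb.trans_le (min_le_right _ _)))
    simpa [e.left_inv ha, e.left_inv hb] using this
  · have := hb₁ (y := ((e a, e b), (e a, v₀))) (by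
      simp only [Prod.dist_eq, dist_self]
      refine max_lt (max_lt ?_ ?_) (max_lt ?_ hδ₁)
      · exact hda.trans_le (min_le_left _ _)
      · exact hdb.trans_le (min_le_left _ _)
      · exact hda.trans_le (min_le_left _ _))
    simp only [e.left_inv ha, e.left_inv hb, hsymm, hm0, Prod.mk_sub_mk, sub_self, hlin,
      Prod.norm_mk, norm_zero, zero_add] at this
    rw [max_eq_right (norm_nonneg _)] at this
    rwa [sub_sub_sub_cancel_right]

/-- Addition and subtraction of a Lie group, read in a chart at the origin, differ from those of
the vector space by a map with vanishing strict derivative; this yields an approximate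
logarithm. -/
theorem nonempty_approxLog [MeasurableSpace K] [BorelSpace K] [MeasurableSpace E] [BorelSpace E]
    [FiniteDimensional ℝ E] [T2Space K]
    [ChartedSpace E K] [LieAddGroup 𝓘(ℝ, E) ∞ K] : Nonempty (ApproxLog K E) := by
  classical
  have : IsTopologicalAddGroup K := topologicalAddGroup_of_lieAddGroup 𝓘(ℝ, E) ∞
  let e : OpenPartialHomeomorph K E := chartAt E (0 : K)
  have h0 : (0 : K) ∈ e.source := mem_chart_source E 0
  set v₀ := e 0 with hv₀
  have hsymm : e.symm v₀ = 0 := e.left_inv h0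
  have htgt : v₀ ∈ e.target := e.map_source h0
  have hcsymm : ContinuousAt e.symm v₀ := e.continuousAt_symm htgt
  have smsymm : ContMDiffAt 𝓘(ℝ, E) 𝓘(ℝ, E) ∞ e.symm v₀ :=
    (contMDiffOn_chart_symm (I := 𝓘(ℝ, E)) (n := ∞) (x := (0 : K))).contMDiffAt
      (e.open_target.mem_nhds htgt)
  have sme : ContMDiffAt 𝓘(ℝ, E) 𝓘(ℝ, E) ∞ e (0 : K) :=
    (contMDiffOn_chart (I := 𝓘(ℝ, E)) (n := ∞) (x := (0 : K))).contMDiffAt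
      (e.open_source.mem_nhds h0)
  have sm1 : ContMDiffAt 𝓘(ℝ, E × E) 𝓘(ℝ, E) ∞ (fun p : E × E => e.symm p.1) (v₀, v₀) :=
    ContMDiffAt.comp (v₀, v₀) (g := e.symm) (f := Prod.fst) smsymm
      contDiff_fst.contMDiff.contMDiffAt
  have sm2 : ContMDiffAt 𝓘(ℝ, E × E) 𝓘(ℝ, E) ∞ (fun p : E × E => e.symm p.2) (v₀, v₀) :=
    ContMDiffAt.comp (v₀, v₀) (g := e.symm) (f := Prod.snd) smsymm
      contDiff_snd.contMDiff.contMDiffAt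
  have smadd : ContDiffAt ℝ ∞ (fun p : E × E => e (e.symm p.1 + e.symm p.2)) (v₀, v₀) := by
    refine ContMDiffAt.contDiffAt ?_
    refine ContMDiffAt.comp (I' := 𝓘(ℝ, E)) (v₀, v₀) (g := e)
      (f := fun p : E × E => e.symm p.1 + e.symm p.2) ?_ (sm1.add sm2)
    simpa only [hsymm, add_zero] using sme
  have smsub : ContDiffAt ℝ ∞ (fun p : E × E => e (e.symm p.1 - e.symm p.2)) (v₀, v₀) := by
    refine ContMDiffAt.contDiffAt ?_
    refine ContMDiffAt.comp (I' := 𝓘(ℝ, E)) (v₀, v₀) (g := e)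
      (f := fun p : E × E => e.symm p.1 - e.symm p.2) ?_ (sm1.sub sm2)
    simpa only [hsymm, sub_zero] using sme
  have hLadd := smadd.hasStrictFDerivAt (by simp)
  have hLsub := smsub.hasStrictFDerivAt (by simp)
  obtain ⟨r₁, hr₁, H₁⟩ := exists_chart_op_estimate e h0 (fun a b => a + b) (fun a => add_zero a)
    continuous_add.continuousAt 1 hLadd (fun w => by
      have h1 : HasFDerivAt (fun v : E => e (e.symm v₀ + e.symm v)) _ v₀ :=
        hLadd.hasFDerivAt.comp v₀ (hasFDerivAt_prodMk_right v₀ v₀)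
      have h2 : HasFDerivAt (fun v : E => e (e.symm v₀ + e.symm v))
          (ContinuousLinearMap.id ℝ E) v₀ := by
        refine (hasFDerivAt_id v₀).congr_of_eventuallyEq ?_
        filter_upwards [e.open_target.mem_nhds htgt] with v hv
        simp [hsymm, e.right_inv hv]
      have := congrArg (fun T : E →L[ℝ] E => T w) (h1.unique h2)
      simpa using this)
  obtain ⟨r₂, hr₂, H₂⟩ := exists_chart_op_estimate e h0 (fun a b => a - b) (fun a => sub_zero a)
    continuous_sub.continuousAt (-1) hLsub (fun w => by
      have h1 : HasFDerivAt (fun v : E => e (e.symm v - e.symm v)) _ v₀ :=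
        hLsub.hasFDerivAt.comp (f := fun v : E => (v, v)) v₀
          ((hasFDerivAt_id v₀).prodMk (hasFDerivAt_id v₀))
      have h2 : HasFDerivAt (fun v : E => e (e.symm v - e.symm v)) (0 : E →L[ℝ] E) v₀ := by
        simp only [sub_self]
        exact hasFDerivAt_const _ _
      have h3 : HasFDerivAt (fun v : E => e (e.symm v - e.symm v₀)) _ v₀ :=
        hLsub.hasFDerivAt.comp (f := fun v : E => (v, v₀)) v₀ (hasFDerivAt_prodMk_left v₀ v₀)
      have h4 : HasFDerivAt (fun v : E => e (e.symm v - e.symm v₀))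
          (ContinuousLinearMap.id ℝ E) v₀ := by
        refine (hasFDerivAt_id v₀).congr_of_eventuallyEq ?_
        filter_upwards [e.open_target.mem_nhds htgt] with v hv
        simp [hsymm, e.right_inv hv]
      have e1 := congrArg (fun T : E →L[ℝ] E => T w) (h1.unique h2)
      have e2 := congrArg (fun T : E →L[ℝ] E => T w) (h3.unique h4)
      simp only [ContinuousLinearMap.comp_apply, ContinuousLinearMap.prod_apply,
        ContinuousLinearMap.id_apply, zero_apply,
        ContinuousLinearMap.inl_apply] at e1 e2
      have e3 : ((0, w) : E × E) = (w, w) - (w, 0) := by simp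
      rw [e3, map_sub, e1, e2]
      simp)
  obtain ⟨r₃, hr₃, H₃⟩ := Metric.nhds_basis_closedBall.mem_iff.1 (e.open_target.mem_nhds htgt)
  let size : K → ℝ := e.source.piecewise (fun a => ‖e a - v₀‖) fun _ => 1
  let log : K → E := e.source.piecewise (fun a => e a - v₀) fun _ => 0
  let exp : E → K := fun v => e.target.piecewise e.symm (fun _ => 0) (v + v₀)
  have size_in : ∀ a ∈ e.source, size a = ‖e a - v₀‖ := fun a ha => piecewise_eq_of_mem _ _ _ ha
  have log_in : ∀ a ∈ e.source, log a = e a - v₀ := fun a ha => piecewise_eq_of_mem _ _ _ ha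
  have src : ∀ a, size a < 1 → a ∈ e.source := by
    intro a ha
    by_contra hn
    have : size a = 1 := piecewise_eq_of_notMem _ _ _ hn
    linarith
  let r := min (min r₁ r₂) (min r₃ (1 / 2))
  have hr1 : r ≤ r₁ := (min_le_left _ _).trans (min_le_left _ _)
  have hr2 : r ≤ r₂ := (min_le_left _ _).trans (min_le_right _ _)
  have hr3 : r ≤ r₃ := (min_le_right _ _).trans (min_le_left _ _)
  have hr4 : r < 1 := ((min_le_right _ _).trans (min_le_right _ _)).trans_lt (by norm_num)
  have srcr : ∀ a, size a ≤ r → a ∈ e.source := fun a ha => src a (ha.trans_lt hr4)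
  have hexp : ∀ v, ‖v‖ ≤ r → v + v₀ ∈ e.target ∧ exp v = e.symm (v + v₀) := by
    intro v hv
    have h : v + v₀ ∈ e.target := H₃ (by simpa using hv.trans hr3)
    exact ⟨h, piecewise_eq_of_mem _ _ _ h⟩
  have hexp' : ∀ v, ‖v‖ ≤ r → exp v ∈ e.source ∧ e (exp v) - v₀ = v := by
    intro v hv
    obtain ⟨h1, h2⟩ := hexp v hv
    rw [h2]
    exact ⟨e.map_target h1, by rw [e.right_inv h1]; simp⟩
  have hce : ContinuousOn e e.source := e.continuousOn
  refine ⟨{ size := size, log := log, exp := exp, radius := r, radius_pos := by positivity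
            measurable_size := ?_, measurable_log := ?_, measurable_exp := ?_
            hasBasis_nhds := ?_, norm_log := ?_, log_exp := ?_, size_exp := ?_, size_add := ?_
            size_sub := ?_, log_add := ?_, log_sub := ?_ }⟩
  · exact (hce.sub continuousOn_const).norm.measurable_piecewise continuousOn_const
      e.open_source.measurableSet
  · exact (hce.sub continuousOn_const).measurable_piecewise continuousOn_const
      e.open_source.measurableSet
  · exact (e.continuousOn_symm.measurable_piecewise continuousOn_const
      e.open_target.measurableSet).comp (measurable_add_const v₀)
  · refine ⟨fun V => ⟨fun hV => ?_, ?_⟩⟩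
    · have h1 : e.symm ⁻¹' V ∈ 𝓝 v₀ := hcsymm.preimage_mem_nhds (by rwa [hsymm])
      obtain ⟨δ, hδ, hδV⟩ := Metric.nhds_basis_closedBall.mem_iff.1 h1
      refine ⟨min δ (1 / 2), by positivity, fun a (ha : size a ≤ _) => ?_⟩
      have has : a ∈ e.source := src a ((ha.trans (min_le_right _ _)).trans_lt (by norm_num))
      have : e a ∈ e.symm ⁻¹' V := hδV (by
        rw [mem_closedBall_iff_norm, ← size_in a has]
        exact ha.trans (min_le_left _ _))
      rwa [mem_preimage, e.left_inv has] at this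
    · rintro ⟨s, hs, hsV⟩
      refine mem_of_superset ?_ hsV
      have h1 : e ⁻¹' Metric.closedBall v₀ s ∈ 𝓝 (0 : K) :=
        (e.continuousAt h0).preimage_mem_nhds (Metric.closedBall_mem_nhds _ hs)
      filter_upwards [h1, e.open_source.mem_nhds h0] with a ha has
      rw [size_in a has, ← mem_closedBall_iff_norm]
      exact ha
  · intro a ha
    rw [size_in a (srcr a ha), log_in a (srcr a ha)]
  · intro v hv
    rw [log_in _ (hexp' v hv).1, (hexp' v hv).2]
  · intro v hv
    rw [size_in _ (hexp' v hv).1, (hexp' v hv).2]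
  · intro a b ha hb
    have has := srcr a ha
    have hbs := srcr b hb
    rw [size_in a has] at ha
    rw [size_in b hbs] at hb
    have h := (H₁ a has b hbs (ha.trans hr1) (hb.trans hr1)).1
    rw [size_in _ h, log_in _ h]
  · intro a b ha hb
    have has := srcr a ha
    have hbs := srcr b hb
    rw [size_in a has] at ha
    rw [size_in b hbs] at hb
    have h := (H₂ a has b hbs (ha.trans hr2) (hb.trans hr2)).1
    rw [size_in _ h, log_in _ h]
  · intro a b ha hb
    have has := srcr a ha
    have hbs := srcr b hb
    rw [size_in a has] at ha
    rw [size_in b hbs] at hb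
    obtain ⟨h1, h2⟩ := H₁ a has b hbs (ha.trans hr1) (hb.trans hr1)
    rw [log_in _ h1, log_in _ has, log_in _ hbs, size_in _ hbs]
    simpa using h2
  · intro a b ha hb
    have has := srcr a ha
    have hbs := srcr b hb
    rw [size_in a has] at ha
    rw [size_in b hbs] at hb
    obtain ⟨h1, h2⟩ := H₂ a has b hbs (ha.trans hr2) (hb.trans hr2)
    rw [log_in _ h1, log_in _ has, log_in _ hbs, size_in _ hbs]
    simp only [neg_smul, one_smul, sub_neg_eq_add] at h2
    exact h2

end Chart

/-! ### Primitives on pairs of points and their defect of additivity -/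

section Additive

variable {X K : Type*} [AddCommGroup K]

/-- The defect of additivity of a two-point function: `G (x, y) + G (y, z) - G (x, z)`. -/
def defect (G : X × X → K) (q : (X × X) × X) : K :=
  G q.1 + G (q.1.2, q.2) - G (q.1.1, q.2)

theorem defect_sub (G J : X × X → K) (q : (X × X) × X) :
    defect (fun p => G p - J p) q =
      defect G q - (J q.1 + J (q.1.2, q.2) - J (q.1.1, q.2)) := by
  simp only [defect]
  abel

/-- The defect is a `2`-cocycle. -/
theorem defect_eq (G : X × X → K) (x y z w : X) :
    defect G ((x, y), z) = defect G ((x, y), w) + defect G ((y, z), w) - defect G ((x, z), w) := by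
  simp only [defect]
  abel

/-- The cocycle identity, comparing the defects at `(x, y)` completed by `z` and by `w`. -/
theorem defect_eq' (G : X × X → K) (x y z w : X) :
    defect G ((x, y), z) = defect G ((x, y), w) + defect G ((x, w), z) - defect G ((y, w), z) := by
  simp only [defect]
  abel

theorem measurable_defect [MeasurableSpace X] [MeasurableSpace K] [MeasurableAdd₂ K]
    [MeasurableSub₂ K] {G : X × X → K} (hG : Measurable G) : Measurable (defect G) := by
  unfold defect
  fun_prop

/-- An almost sure property of pairs holds for the three ordered pairs of almost every triple. -/
theorem ae_forall_pairs {X : Type*} [MeasurableSpace X] {m : Measure X} [IsProbabilityMeasure m]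
    {P : X × X → Prop} (h : ∀ᵐ p ∂m.prod m, P p) :
    ∀ᵐ q ∂(m.prod m).prod m, P q.1 ∧ P (q.1.2, q.2) ∧ P (q.1.1, q.2) := by
  have h1 : Measure.QuasiMeasurePreserving (Prod.map Prod.snd id : (X × X) × X → X × X)
      ((m.prod m).prod m) (m.prod m) :=
    (measurePreserving_snd.prod (MeasurePreserving.id m)).quasiMeasurePreserving
  have h2 : Measure.QuasiMeasurePreserving (Prod.map Prod.fst id : (X × X) × X → X × X)
      ((m.prod m).prod m) (m.prod m) :=
    (measurePreserving_fst.prod (MeasurePreserving.id m)).quasiMeasurePreserving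
  filter_upwards [Measure.quasiMeasurePreserving_fst.ae h, h1.ae h, h2.ae h] with q a b c
    using ⟨a, b, c⟩

/-- An almost sure property of triples holds, for almost every triple and a further random point
`w`, for the triple and for its three pairs completed by `w`. -/
theorem ae_forall_triples {X : Type*} [MeasurableSpace X] {m : Measure X} [IsProbabilityMeasure m]
    {P : (X × X) × X → Prop} (h : ∀ᵐ q ∂(m.prod m).prod m, P q) :
    ∀ᵐ q ∂(m.prod m).prod m, P q ∧ ∀ᵐ w ∂m,
      P (q.1, w) ∧ P ((q.1.2, q.2), w) ∧ P ((q.1.1, q.2), w) := by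
  filter_upwards [h, ae_forall_pairs (Measure.ae_ae_of_ae_prod h)] with q h0 hq
  exact ⟨h0, by filter_upwards [hq.1, hq.2.1, hq.2.2] with w a b c using ⟨a, b, c⟩⟩

end Additive

section Dynamics

variable {Γ X K : Type*} [MeasurableSpace X] [AddCommGroup K]

/-- `G` is a primitive of the difference `σ (y) - σ (x)` for the diagonal action on `X × X`. -/
def IsDifferencePrimitive (m : Measure X) (S : Γ → X → X) (σ : Γ → X → K) (G : X × X → K) :
    Prop :=
  ∀ γ, ∀ᵐ p ∂m.prod m, G (S γ p.1, S γ p.2) - G p = σ γ p.2 - σ γ p.1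

variable {m : Measure X} {S : Γ → X → X}

theorem IsDifferencePrimitive.defect_invariant [IsProbabilityMeasure m] {σ : Γ → X → K} {G : X × X → K}
    (h : IsDifferencePrimitive m S σ G) (γ : Γ) :
    ∀ᵐ q ∂(m.prod m).prod m,
      defect G ((S γ q.1.1, S γ q.1.2), S γ q.2) = defect G q := by
  filter_upwards [ae_forall_pairs (h γ)] with q ⟨h1, h2, h3⟩
  simp only [defect]
  rw [sub_eq_iff_eq_add.1 h1, sub_eq_iff_eq_add.1 h2, sub_eq_iff_eq_add.1 h3]
  abel

theorem IsDifferencePrimitive.sub_invariant {σ : Γ → X → K} {G J : X × X → K}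
    (h : IsDifferencePrimitive m S σ G)
    (hJ : ∀ γ, ∀ᵐ p ∂m.prod m, J (S γ p.1, S γ p.2) = J p) :
    IsDifferencePrimitive m S σ fun p => G p - J p := by
  intro γ
  filter_upwards [h γ, hJ γ] with p h1 h2
  rw [h2, ← h1]
  abel

/-- The law of the defect at a given pair depends on the pair in an invariant way. -/
theorem IsDifferencePrimitive.map_defect_invariant [IsProbabilityMeasure m]
    [MeasurableSpace K] [MeasurableAdd₂ K] [MeasurableSub₂ K]
    (hS : ∀ γ, MeasurePreserving (S γ) m m) {σ : Γ → X → K} {G : X × X → K} (h : IsDifferencePrimitive m S σ G) (hG : Measurable G)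
    (γ : Γ) :
    ∀ᵐ p ∂m.prod m, m.map (fun w => defect G ((S γ p.1, S γ p.2), w)) =
      m.map (fun w => defect G (p, w)) := by
  have hd := measurable_defect hG
  filter_upwards [Measure.ae_ae_of_ae_prod (h.defect_invariant γ)] with p hp
  conv_lhs => rw [← (hS γ).map_eq]
  have hm : Measurable fun w => defect G ((S γ p.1, S γ p.2), w) := by fun_prop
  rw [Measure.map_map hm (hS γ).measurable]
  exact Measure.map_congr hp

end Dynamics

section Newton

variable {K E : Type*} [AddCommGroup K] [TopologicalSpace K] [MeasurableSpace K]
  [NormedAddCommGroup E] [MeasurableSpace E]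

namespace ApproxLog

variable (L : ApproxLog K E)

theorem size_zero_le : L.size 0 ≤ 0 :=
  le_of_forall_pos_le_add fun s hs => by
    simpa using mem_of_mem_nhds (L.hasBasis_nhds.mem_of_mem hs)

theorem size_add_le {a b : K} (ha : L.size a ≤ L.radius) (hb : L.size b ≤ L.radius) :
    L.size (a + b) ≤ L.size a + 101 / 100 * L.size b := by
  rw [L.size_add a b ha hb]
  have h1 := L.log_add a b ha hb
  have h2 : L.log (a + b) = (L.log (a + b) - L.log a - L.log b) + L.log a + L.log b := by abel
  have h3 := norm_add₃_le (a := L.log (a + b) - L.log a - L.log b) (b := L.log a) (c := L.log b)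
  rw [← h2, L.norm_log a ha, L.norm_log b hb] at h3
  linarith

/-- The approximate logarithm is nearly additive on combinations `a + b - c`. -/
theorem log_add_sub {a b c : K} {ε : ℝ} (hε : 4 * ε ≤ L.radius) (ha : L.size a ≤ ε)
    (hb : L.size b ≤ ε) (hc : L.size c ≤ ε) :
    L.size (a + b - c) = ‖L.log (a + b - c)‖ ∧
      ‖L.log (a + b - c) - (L.log a + L.log b - L.log c)‖ ≤ ε / 50 ∧
      L.size (a + b - c) ≤ 4 * ε := by
  have hr := L.radius_pos
  have har : L.size a ≤ L.radius := by linarith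
  have hbr : L.size b ≤ L.radius := by linarith
  have hcr : L.size c ≤ L.radius := by linarith
  have na : 0 ≤ L.size a := by rw [← L.norm_log a har]; exact norm_nonneg _
  have hab : L.size (a + b) ≤ L.radius := (L.size_add_le har hbr).trans (by linarith)
  have h1 := L.log_add a b har hbr
  have h2 := L.log_sub (a + b) c hab hcr
  have key : ‖L.log (a + b - c) - (L.log a + L.log b - L.log c)‖ ≤ ε / 50 := by
    have e : L.log (a + b - c) - (L.log a + L.log b - L.log c) =
        (L.log (a + b - c) - L.log (a + b) + L.log c) +
          (L.log (a + b) - L.log a - L.log b) := by abel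
    rw [e]
    exact (norm_add_le _ _).trans (by linarith)
  refine ⟨L.size_sub _ _ hab hcr, key, ?_⟩
  rw [L.size_sub _ _ hab hcr]
  have e : L.log (a + b - c) = (L.log (a + b - c) - (L.log a + L.log b - L.log c)) +
      (L.log a + L.log b - L.log c) := by abel
  rw [e]
  have h3 := norm_sub_le (L.log a + L.log b) (L.log c)
  have h4 := norm_add_le (L.log a) (L.log b)
  rw [L.norm_log a har, L.norm_log b hbr] at h4
  rw [L.norm_log c hcr] at h3
  exact (norm_add_le _ _).trans (by linarith)

/-- A sequence whose consecutive differences have geometrically decaying size converges. -/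
theorem exists_tendsto [IsTopologicalAddGroup K] [CompactSpace K] {ε : ℝ}
    (hε : 4 * ε ≤ L.radius) {c : ℕ → K} (hc : ∀ n, L.size (c n - c (n + 1)) ≤ ε / 2 ^ n) :
    ∃ a, Tendsto c atTop (𝓝 a) := by
  have hr := L.radius_pos
  have hn0 : ∀ n, 0 ≤ ε / 2 ^ n := by
    intro n
    by_contra! hneg
    have h1 : L.size (c n - c (n + 1)) ≤ L.radius := (hc n).trans (by linarith)
    have h2 := L.norm_log _ h1
    linarith [norm_nonneg (L.log (c n - c (n + 1))), hc n]
  have hε0 : 0 ≤ ε := by simpa using hn0 0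
  have hεn : ∀ n, ε / 2 ^ n ≤ ε := fun n => div_le_self hε0 (one_le_pow₀ (by norm_num))
  have key : ∀ k n, L.size (c n - c (n + k)) ≤ 4 * (ε / 2 ^ n) := by
    intro k
    induction k with
    | zero =>
      intro n
      simp only [add_zero, sub_self]
      exact L.size_zero_le.trans (by linarith [hn0 n])
    | succ k ih =>
      intro n
      have e : c n - c (n + (k + 1)) = (c n - c (n + 1)) + (c (n + 1) - c (n + 1 + k)) := by
        rw [show n + (k + 1) = n + 1 + k by ring]
        abel
      have h1 := hc n
      have h2 := ih (n + 1)
      have h3 : ε / 2 ^ (n + 1) = ε / 2 ^ n / 2 := by rw [pow_succ]; field_simp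
      rw [h3] at h2
      have := hεn n
      have := hn0 n
      rw [e]
      exact (L.size_add_le (h1.trans (by linarith)) (h2.trans (by linarith))).trans
        (by linarith)
  let _ : UniformSpace K := IsTopologicalAddGroup.rightUniformSpace K
  have : IsUniformAddGroup K := isUniformAddGroup_of_addCommGroup
  refine cauchySeq_tendsto_of_complete ?_
  have hb : (uniformity K).HasBasis (fun s : ℝ => 0 < s)
      (fun s => (fun p : K × K => p.2 - p.1) ⁻¹' {a | L.size a ≤ s}) := by
    rw [uniformity_eq_comap_nhds_zero]
    exact L.hasBasis_nhds.comap _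
  refine hb.cauchySeq_iff'.2 fun s hs => ?_
  have hlim : Tendsto (fun n : ℕ => 4 * (ε / 2 ^ n)) atTop (𝓝 (4 * 0)) := by
    refine Tendsto.const_mul _ ?_
    have := (tendsto_pow_atTop_nhds_zero_of_lt_one (r := (1 / 2 : ℝ)) (by norm_num)
      (by norm_num)).const_mul ε
    simpa [div_eq_mul_inv] using this
  obtain ⟨N, hN⟩ := (hlim.eventually (gt_mem_nhds (show 4 * (0 : ℝ) < s by simpa))).exists
  refine ⟨N, fun n hn => ?_⟩
  obtain ⟨k, rfl⟩ := Nat.exists_eq_add_of_le hn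
  exact (key k N).trans hN.le

end ApproxLog

variable {Γ X : Type*} [MeasurableSpace X] {m : Measure X} [IsProbabilityMeasure m]
  {S : Γ → X → X} [NormedSpace ℝ E] [CompleteSpace E] [BorelSpace E] [SecondCountableTopology E]
  [MeasurableAdd₂ K] [MeasurableSub₂ K]

/-- Averaging the logarithm of the defect over its last point gives an invariant correction that
halves the size of the defect. -/
theorem ApproxLog.exists_correction (L : ApproxLog K E) (hS : ∀ γ, MeasurePreserving (S γ) m m)
    {σ : Γ → X → K} {G : X × X → K} (hG : Measurable G) (h : IsDifferencePrimitive m S σ G)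
    {ε : ℝ} (hε0 : 0 ≤ ε) (hε : 4 * ε ≤ L.radius)
    (hd : ∀ᵐ q ∂(m.prod m).prod m, L.size (defect G q) ≤ ε) :
    ∃ J : X × X → K, Measurable J ∧ (∀ p, L.size (J p) ≤ ε) ∧
      (∀ γ, ∀ᵐ p ∂m.prod m, J (S γ p.1, S γ p.2) = J p) ∧
      ∀ᵐ q ∂(m.prod m).prod m, L.size (defect (fun p => G p - J p) q) ≤ ε / 2 := by
  have hr := L.radius_pos
  have hmd := measurable_defect hG
  -- truncation makes the average bounded at every pair
  let ψ : K → E := {a | L.size a ≤ ε}.indicator L.log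
  have hψ : Measurable ψ :=
    L.measurable_log.indicator (measurableSet_le L.measurable_size measurable_const)
  have hψb : ∀ a, ‖ψ a‖ ≤ ε := by
    intro a
    by_cases ha : L.size a ≤ ε
    · have : ψ a = L.log a := indicator_of_mem (s := {a | L.size a ≤ ε}) ha _
      rw [this, L.norm_log a (by linarith)]
      exact ha
    · have : ψ a = 0 := indicator_of_notMem (s := {a | L.size a ≤ ε}) ha _
      rw [this, norm_zero]
      exact hε0
  have hψin : ∀ a, L.size a ≤ ε → ψ a = L.log a := fun a ha =>
    indicator_of_mem (s := {a | L.size a ≤ ε}) ha _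
  let A : X × X → E := fun p => ∫ w, ψ (defect G (p, w)) ∂m
  have hint : ∀ p, Integrable (fun w => ψ (defect G (p, w))) m := fun p =>
    Integrable.of_bound (hψ.comp (hmd.comp measurable_prodMk_left)).aestronglyMeasurable ε
      (.of_forall fun w => hψb _)
  have hA : Measurable A :=
    ((hψ.comp hmd).stronglyMeasurable.integral_prod_right').measurable
  have hAb : ∀ p, ‖A p‖ ≤ ε := fun p => by
    simpa using norm_integral_le_of_norm_le_const (μ := m) (.of_forall fun w => hψb _)
  have hAr : ∀ p, ‖A p‖ ≤ L.radius := fun p => (hAb p).trans (by linarith)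
  let J : X × X → K := fun p => L.exp (A p)
  have hJb : ∀ p, L.size (J p) ≤ ε := fun p => by
    rw [L.size_exp _ (hAr p)]
    exact hAb p
  have hlogJ : ∀ p, L.log (J p) = A p := fun p => L.log_exp _ (hAr p)
  refine ⟨J, L.measurable_exp.comp hA, hJb, fun γ => ?_, ?_⟩
  · filter_upwards [h.map_defect_invariant hS hG γ] with p hp
    have hAmap : ∀ p, A p = ∫ a, ψ a ∂(m.map fun w => defect G (p, w)) := fun p =>
      (integral_map (hmd.comp measurable_prodMk_left).aemeasurable
        hψ.aestronglyMeasurable).symm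
    simp only [J, hAmap, hp]
  · filter_upwards [ae_forall_triples hd] with q ⟨hq, hw⟩
    obtain ⟨⟨x, y⟩, z⟩ := q
    simp only at hw
    have havg : ‖L.log (defect G ((x, y), z)) - (A (x, y) + A (y, z) - A (x, z))‖ ≤ ε / 50 := by
      have e : L.log (defect G ((x, y), z)) - (A (x, y) + A (y, z) - A (x, z)) =
          ∫ w, (L.log (defect G ((x, y), z)) - (ψ (defect G ((x, y), w)) +
            ψ (defect G ((y, z), w)) - ψ (defect G ((x, z), w)))) ∂m := by
        have i₁ := hint (x, y)
        have i₂ := hint (y, z)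
        have i₃ := hint (x, z)
        have i₁₂ : Integrable (fun w => ψ (defect G ((x, y), w)) + ψ (defect G ((y, z), w))) m :=
          i₁.add i₂
        have i₁₂₃ : Integrable (fun w => ψ (defect G ((x, y), w)) + ψ (defect G ((y, z), w)) -
            ψ (defect G ((x, z), w))) m := i₁₂.sub i₃
        rw [integral_sub (integrable_const _) i₁₂₃, integral_sub i₁₂ i₃,
          integral_add i₁ i₂]
        simp [A]
      rw [e]
      refine (norm_integral_le_of_norm_le_const (C := ε / 50) ?_).trans (by simp)
      filter_upwards [hw] with w ⟨h1, h2, h3⟩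
      rw [hψin _ h1, hψin _ h2, hψin _ h3, defect_eq G x y z w]
      exact (L.log_add_sub hε h1 h2 h3).2.1
    obtain ⟨-, hs1, hs2⟩ := L.log_add_sub hε (hJb (x, y)) (hJb (y, z)) (hJb (x, z))
    rw [hlogJ, hlogJ, hlogJ] at hs1
    rw [defect_sub]
    set a := defect G ((x, y), z)
    set s := J (x, y) + J (y, z) - J (x, z)
    have har : L.size a ≤ L.radius := hq.trans (by linarith)
    have hsr : L.size s ≤ L.radius := hs2.trans hε
    change L.size (a - s) ≤ ε / 2
    rw [L.size_sub a s har hsr]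
    have h4 := L.log_sub a s har hsr
    have e : L.log (a - s) = (L.log (a - s) - L.log a + L.log s) +
        (L.log a - (A (x, y) + A (y, z) - A (x, z))) -
        (L.log s - (A (x, y) + A (y, z) - A (x, z))) := by abel
    rw [e]
    have h5 := norm_sub_le ((L.log (a - s) - L.log a + L.log s) +
        (L.log a - (A (x, y) + A (y, z) - A (x, z))))
        (L.log s - (A (x, y) + A (y, z) - A (x, z)))
    have h6 := norm_add_le (L.log (a - s) - L.log a + L.log s)
        (L.log a - (A (x, y) + A (y, z) - A (x, z)))
    linarith

/-- Newton iteration: a primitive with uniformly small defect can be corrected to one with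
vanishing defect. -/
theorem ApproxLog.exists_additive_primitive (L : ApproxLog K E) [IsTopologicalAddGroup K]
    [CompactSpace K] [BorelSpace K] [TopologicalSpace.PseudoMetrizableSpace K] [T2Space K]
    (hS : ∀ γ, MeasurePreserving (S γ) m m)
    {σ : Γ → X → K} {G : X × X → K} (hG : Measurable G) (h : IsDifferencePrimitive m S σ G)
    {ε : ℝ} (hε0 : 0 ≤ ε) (hε : 4 * ε ≤ L.radius)
    (hd : ∀ᵐ q ∂(m.prod m).prod m, L.size (defect G q) ≤ ε) :
    ∃ G' : X × X → K, Measurable G' ∧ IsDifferencePrimitive m S σ G' ∧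
      ∀ᵐ q ∂(m.prod m).prod m, defect G' q = 0 := by
  let good : ℕ → (X × X → K) → Prop := fun n G => Measurable G ∧ IsDifferencePrimitive m S σ G ∧
    ∀ᵐ q ∂(m.prod m).prod m, L.size (defect G q) ≤ ε / 2 ^ n
  have step : ∀ n G, good n G → ∃ G', good (n + 1) G' ∧
      ∀ p, L.size (G p - G' p) ≤ ε / 2 ^ n := by
    rintro n G ⟨h1, h2, h3⟩
    have hle : ε / 2 ^ n ≤ ε := div_le_self hε0 (one_le_pow₀ (by norm_num))
    obtain ⟨J, hJ, hJb, hJi, hJd⟩ := L.exists_correction hS h1 h2 (ε := ε / 2 ^ n) (by positivity)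
      (by linarith) h3
    refine ⟨fun p => G p - J p, ⟨h1.sub hJ, h2.sub_invariant hJi, ?_⟩, fun p => ?_⟩
    · refine hJd.mono fun q hq => hq.trans (le_of_eq ?_)
      rw [pow_succ]
      field_simp
    · simpa using hJb p
  choose! f hf hfr using step
  let H : ℕ → X × X → K := fun n => Nat.rec G (fun n g => f n g) n
  have hH : ∀ n, good n (H n) := by
    intro n
    induction n with
    | zero => exact ⟨hG, h, by simpa [H] using hd⟩
    | succ n ih => exact hf n _ ih
  choose G' hG' using fun p => L.exists_tendsto hε (c := fun n => H n p) fun n =>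
    hfr n _ (hH n) p
  refine ⟨G', measurable_of_tendsto_metrizable (fun n => (hH n).1) (tendsto_pi_nhds.2 hG'),
    fun γ => ?_, ?_⟩
  · filter_upwards [ae_all_iff.2 fun n => (hH n).2.1 γ] with p hp
    have hl : Tendsto (fun n => H n (S γ p.1, S γ p.2) - H n p) atTop
        (𝓝 (G' (S γ p.1, S γ p.2) - G' p)) := (hG' _).sub (hG' _)
    exact tendsto_nhds_unique hl (tendsto_const_nhds.congr fun n => (hp n).symm)
  · filter_upwards [ae_all_iff.2 fun n => (hH n).2.2] with q hq
    have hl : Tendsto (fun n => defect (H n) q) atTop (𝓝 (defect G' q)) :=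
      ((hG' _).add (hG' _)).sub (hG' _)
    refine tendsto_nhds_unique hl (L.hasBasis_nhds.tendsto_right_iff.2 fun s hs => ?_)
    have hlim : Tendsto (fun n : ℕ => ε / 2 ^ n) atTop (𝓝 0) := by
      have := (tendsto_pow_atTop_nhds_zero_of_lt_one (r := (1 / 2 : ℝ)) (by norm_num)
        (by norm_num)).const_mul ε
      simpa [div_eq_mul_inv] using this
    filter_upwards [hlim.eventually (gt_mem_nhds hs)] with n hn
    exact (hq n).trans hn.le

end Newton

/-! ### Primitives that are small in measure -/

theorem exists_open_add_sub_mem {K : Type*} [AddCommGroup K] [TopologicalSpace K]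
    [IsTopologicalAddGroup K] {V : Set K} (hV : V ∈ 𝓝 (0 : K)) :
    ∃ U : Set K, IsOpen U ∧ 0 ∈ U ∧ ∀ a ∈ U, ∀ b ∈ U, ∀ c ∈ U, a + b - c ∈ V := by
  have hcont : Continuous fun p : K × K × K => p.1 + p.2.1 - p.2.2 := by fun_prop
  have h : (fun p : K × K × K => p.1 + p.2.1 - p.2.2) ⁻¹' V ∈ 𝓝 ((0 : K), (0 : K), (0 : K)) :=
    hcont.continuousAt.preimage_mem_nhds (by simpa using hV)
  rw [nhds_prod_eq, nhds_prod_eq] at h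
  obtain ⟨A, hA, B, hB, hAB⟩ := mem_prod_iff.1 h
  obtain ⟨C, hC, D, hD, hCD⟩ := mem_prod_iff.1 hB
  obtain ⟨U, hU, hUo, h0⟩ := mem_nhds_iff.1 (inter_mem hA (inter_mem hC hD))
  exact ⟨U, hUo, h0, fun a ha b hb c hc =>
    @hAB (a, b, c) ⟨(hU ha).1, hCD ⟨(hU hb).2.1, (hU hc).2.2⟩⟩⟩

theorem exists_notMem_of_measure_add_lt {X : Type*} [MeasurableSpace X] {m : Measure X}
    [IsProbabilityMeasure m] {A B C : Set X} (h : m A + m B + m C < 1) :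
    ∃ w, w ∉ A ∧ w ∉ B ∧ w ∉ C := by
  by_contra! hw
  have hu : (univ : Set X) ⊆ A ∪ B ∪ C := fun w _ => by
    by_cases hA : w ∈ A
    · exact Or.inl (Or.inl hA)
    · by_cases hB : w ∈ B
      · exact Or.inl (Or.inr hB)
      · exact Or.inr (hw w hA hB)
  have : m univ ≤ m A + m B + m C := (measure_mono hu).trans
    ((measure_union_le _ _).trans (by gcongr; exact measure_union_le _ _))
  rw [measure_univ] at this
  exact absurd h this.not_gt

/-- Markov's inequality for slices of a set of small product measure. -/
theorem measure_slice_ge_lt {A B : Type*} [MeasurableSpace A] [MeasurableSpace B] {α : Measure A}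
    {β : Measure B} [SFinite β] {s : Set (A × B)} (hs : MeasurableSet s) {c d : ENNReal}
    (hc : c ≠ 0) (hc' : c ≠ ⊤) (h : (α.prod β) s < c * d) :
    α {a | c ≤ β (Prod.mk a ⁻¹' s)} < d := by
  have h1 : c * α {a | c ≤ β (Prod.mk a ⁻¹' s)} ≤ (α.prod β) s := by
    rw [Measure.prod_apply hs]
    exact mul_meas_ge_le_lintegral (measurable_measure_prodMk_left hs) c
  exact (ENNReal.mul_lt_mul_iff_right hc hc').1 (h1.trans_lt h)

section Center

variable {K : Type*} [AddCommGroup K]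

open Classical in
/-- The first point of the sequence `d` around which the measure `ν` is concentrated, in the
sense that less than a quarter of `ν` lies outside its translate of `V`; the first point of the
sequence if there is none. -/
noncomputable def center [MeasurableSpace K] (d : ℕ → K) (V : Set K) (ν : Measure K) : K :=
  if h : ∃ n, ν {k | k - d n ∉ V} < 4⁻¹ then d (Nat.find h) else d 0

theorem measure_sub_center_notMem_lt [MeasurableSpace K] {d : ℕ → K} {V : Set K} {ν : Measure K}
    (h : ∃ n, ν {k | k - d n ∉ V} < 4⁻¹) : ν {k | k - center d V ν ∉ V} < 4⁻¹ := by
  classical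
  rw [center, dif_pos h]
  exact Nat.find_spec h

theorem measurable_center [MeasurableSpace K] [MeasurableSub₂ K] {W : Type*} [MeasurableSpace W]
    {d : ℕ → K} {V : Set K} (hV : MeasurableSet V) {ν : W → Measure K} (hν : Measurable ν) :
    Measurable fun w => center d V (ν w) := by
  classical
  let p : W → ℕ → Prop := fun w n => ν w {k | k - d n ∉ V} < 4⁻¹ ∨
    ¬ ∃ n, ν w {k | k - d n ∉ V} < 4⁻¹
  have hm : ∀ n, MeasurableSet {w | ν w {k | k - d n ∉ V} < 4⁻¹} := fun n =>
    measurableSet_lt ((Measure.measurable_coe ((measurable_id.sub_const (d n)) hV.compl)).comp hν)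
      measurable_const
  have hex : MeasurableSet {w | ∃ n, ν w {k | k - d n ∉ V} < 4⁻¹} := by
    rw [ofPred_exists]
    exact .iUnion hm
  have hp : ∀ w, ∃ n, p w n := fun w => by
    by_cases h : ∃ n, ν w {k | k - d n ∉ V} < 4⁻¹
    · obtain ⟨n, hn⟩ := h
      exact ⟨n, Or.inl hn⟩
    · exact ⟨0, Or.inr h⟩
  have e : (fun w => center d V (ν w)) = fun w => d (Nat.find (hp w)) := by
    funext w
    by_cases h : ∃ n, ν w {k | k - d n ∉ V} < 4⁻¹
    · have : ∀ n, p w n ↔ ν w {k | k - d n ∉ V} < 4⁻¹ := fun n => by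
        simp only [p, not_true_eq_false, or_false, h]
      rw [center, dif_pos h]
      congr 1
      exact Nat.find_congr' (fun {n} => (this n).symm)
    · rw [center, dif_neg h]
      congr 1
      exact ((Nat.find_eq_zero (hp w)).2 (Or.inr h)).symm
  rw [e]
  exact (measurable_from_nat (f := d)).comp
    (measurable_find hp fun n => (hm n).union hex.compl)

end Center

variable {Γ X K : Type*} [MeasurableSpace X] {m : Measure X} [IsProbabilityMeasure m]
  {S : Γ → X → X} [AddCommGroup K] [TopologicalSpace K] [IsTopologicalAddGroup K]
  [SecondCountableTopology K] [MeasurableSpace K] [BorelSpace K]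

/-- In an ergodic system, if the defect of a primitive mostly lies in `U`, then for almost every
first point it mostly lies in `U`. -/
theorem ae_measure_defect_notMem_lt [Countable Γ] (hS : ∀ γ, MeasurePreserving (S γ) m m)
    (herg : IsErgodicSystem m S) {σ : Γ → X → K} {G : X × X → K} (hG : Measurable G)
    (h : IsDifferencePrimitive m S σ G) {U : Set K} (hU : MeasurableSet U) {δ : ENNReal}
    (hδ0 : δ ≠ 0) (hδ : δ ≠ ⊤)
    (hd : ((m.prod m).prod m) {q | defect G q ∉ U} < δ) :
    ∀ᵐ x ∂m, (m.prod m) {p | defect G ((x, p.1), p.2) ∉ U} < δ := by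
  let B : Set (X × X × X) := {r | defect G ((r.1, r.2.1), r.2.2) ∉ U}
  have hmd := measurable_defect hG
  have hB : MeasurableSet B := by
    have : Measurable fun r : X × X × X => defect G ((r.1, r.2.1), r.2.2) := by fun_prop
    exact this hU.compl
  have hassoc := measurePreserving_prodAssoc m m m
  have hBm : (m.prod (m.prod m)) B < δ * 1 := by
    rw [mul_one, ← hassoc.measure_preimage hB.nullMeasurableSet]
    exact hd
  have hlt := measure_slice_ge_lt hB hδ0 hδ hBm
  have hinv : ∀ γ, ∀ᵐ x ∂m, (m.prod m) (Prod.mk (S γ x) ⁻¹' B) = (m.prod m) (Prod.mk x ⁻¹' B) := by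
    intro γ
    have h1 := (hassoc.symm _).quasiMeasurePreserving.ae (h.defect_invariant γ)
    filter_upwards [Measure.ae_ae_of_ae_prod h1] with x hx
    rw [← ((hS γ).prod (hS γ)).measure_preimage
      (hB.preimage measurable_prodMk_left).nullMeasurableSet]
    refine measure_congr (hx.mono fun p hp => ?_)
    change (defect G ((S γ x, S γ p.1), S γ p.2) ∉ U) = (defect G ((x, p.1), p.2) ∉ U)
    have hp' : defect G ((S γ x, S γ p.1), S γ p.2) = defect G ((x, p.1), p.2) := hp
    rw [hp']
  have hms : MeasurableSet {x | δ ≤ (m.prod m) (Prod.mk x ⁻¹' B)} :=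
    measurableSet_le measurable_const (measurable_measure_prodMk_left hB)
  have h0 := (herg {x | δ ≤ (m.prod m) (Prod.mk x ⁻¹' B)} ⟨hms, fun γ => by
    filter_upwards [hinv γ] with x hx
    change (δ ≤ (m.prod m) (Prod.mk (S γ x) ⁻¹' B)) = (δ ≤ (m.prod m) (Prod.mk x ⁻¹' B))
    rw [hx]⟩).resolve_right hlt.ne
  filter_upwards [measure_eq_zero_iff_ae_notMem.1 h0] with x hx
  exact not_le.1 hx

/-- A primitive whose defect is small outside a set of small measure can be corrected by an
invariant function to one whose defect is small almost everywhere. -/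
theorem exists_small_defect_primitive [Countable Γ] {V : Set K} (hV : V ∈ 𝓝 (0 : K)) :
    ∃ U : Set K, IsOpen U ∧ 0 ∈ U ∧ ∃ δ : ENNReal, 0 < δ ∧ ∀ (σ : Γ → X → K) (G : X × X → K),
      (∀ γ, MeasurePreserving (S γ) m m) → IsErgodicSystem m S → Measurable G →
      IsDifferencePrimitive m S σ G → (m.prod m) {p | G p ∉ U} ≤ δ →
      ∃ G' : X × X → K, Measurable G' ∧ IsDifferencePrimitive m S σ G' ∧
        ∀ᵐ q ∂(m.prod m).prod m, defect G' q ∈ V := by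
  obtain ⟨V₁, hV₁o, hV₁0, hV₁⟩ := exists_open_add_sub_mem hV
  obtain ⟨U₂, hU₂o, hU₂0, hU₂⟩ := exists_open_add_sub_mem (hV₁o.mem_nhds hV₁0)
  obtain ⟨U, hUo, hU0, hU⟩ := exists_open_add_sub_mem (hU₂o.mem_nhds hU₂0)
  refine ⟨U, hUo, hU0, 8⁻¹ * 8⁻¹ / 4, by simp,
    fun σ G hS herg hG h hsmall => ?_⟩
  have hmd := measurable_defect hG
  -- the defect mostly lies in `U₂`
  have hbad : ((m.prod m).prod m) {q | defect G q ∉ U₂} < 8⁻¹ * 8⁻¹ := by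
    have hGU : MeasurableSet {p | G p ∉ U} := hG hUo.measurableSet.compl
    have h1 : MeasurePreserving (Prod.map Prod.snd id : (X × X) × X → X × X)
        ((m.prod m).prod m) (m.prod m) := measurePreserving_snd.prod (MeasurePreserving.id m)
    have h2 : MeasurePreserving (Prod.map Prod.fst id : (X × X) × X → X × X)
        ((m.prod m).prod m) (m.prod m) := measurePreserving_fst.prod (MeasurePreserving.id m)
    have h3 : MeasurePreserving (Prod.fst : (X × X) × X → X × X)
        ((m.prod m).prod m) (m.prod m) := measurePreserving_fst
    have hsub : {q : (X × X) × X | defect G q ∉ U₂} ⊆ (Prod.fst ⁻¹' {p | G p ∉ U} ∪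
        Prod.map Prod.snd id ⁻¹' {p | G p ∉ U}) ∪ Prod.map Prod.fst id ⁻¹' {p | G p ∉ U} := by
      intro q hq
      by_contra hn
      simp only [mem_union, mem_preimage, mem_ofPred_eq, not_or, not_not] at hn
      exact hq (hU _ hn.1.1 _ hn.1.2 _ hn.2)
    calc ((m.prod m).prod m) {q | defect G q ∉ U₂}
        ≤ (8⁻¹ * 8⁻¹ / 4 + 8⁻¹ * 8⁻¹ / 4) + 8⁻¹ * 8⁻¹ / 4 := by
          refine (measure_mono hsub).trans ((measure_union_le _ _).trans ?_)
          refine add_le_add ((measure_union_le _ _).trans (add_le_add ?_ ?_)) ?_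
          · rw [h3.measure_preimage hGU.nullMeasurableSet]; exact hsmall
          · rw [h1.measure_preimage hGU.nullMeasurableSet]; exact hsmall
          · rw [h2.measure_preimage hGU.nullMeasurableSet]; exact hsmall
      _ < 8⁻¹ * 8⁻¹ := by
          have e : (8⁻¹ * 8⁻¹ / 4 : ENNReal) = ENNReal.ofReal (1 / 256) := by
            rw [← ENNReal.toReal_eq_toReal_iff' (by finiteness) (by finiteness)]
            norm_num
          have e' : (8⁻¹ * 8⁻¹ : ENNReal) = ENNReal.ofReal (1 / 64) := by
            rw [← ENNReal.toReal_eq_toReal_iff' (by finiteness) (by finiteness)]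
            norm_num
          rw [e, e', ← ENNReal.ofReal_add (by norm_num) (by norm_num),
            ← ENNReal.ofReal_add (by norm_num) (by norm_num)]
          exact (ENNReal.ofReal_lt_ofReal_iff (by norm_num)).2 (by norm_num)
  have h8 : (8⁻¹ : ENNReal) ≠ 0 := by simp
  have h8' : (8⁻¹ : ENNReal) ≠ ⊤ := by simp
  have hgood := ae_measure_defect_notMem_lt hS herg hG h hU₂o.measurableSet
    (by simp : (8⁻¹ * 8⁻¹ : ENNReal) ≠ 0) (by finiteness) hbad
  let d : ℕ → K := TopologicalSpace.denseSeq K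
  let ν : X × X → Measure K := fun p => m.map fun w => defect G (p, w)
  have hν : Measurable ν := by
    refine Measure.measurable_of_measurable_coe _ fun s hs => ?_
    have e : (fun p => ν p s) = fun p => m (Prod.mk p ⁻¹' (defect G ⁻¹' s)) := by
      funext p
      exact Measure.map_apply (hmd.comp measurable_prodMk_left) hs
    rw [e]
    exact measurable_measure_prodMk_left (hmd hs)
  have hνs : ∀ p k, ν p {a | a - k ∉ V₁} = m {w | defect G (p, w) - k ∉ V₁} := fun p k =>
    Measure.map_apply (hmd.comp measurable_prodMk_left)
      ((measurable_id.sub_const k) hV₁o.measurableSet.compl)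
  let P : X × X → K := fun p => center d V₁ (ν p)
  have hP : Measurable P := measurable_center hV₁o.measurableSet hν
  -- for good `x` and `y`, the defect at `(x, y)` concentrates around its value at a typical point
  have hconc : ∀ᵐ p ∂m.prod m, m {w | defect G (p, w) - P p ∉ V₁} < 4⁻¹ := by
    filter_upwards [Measure.quasiMeasurePreserving_fst.ae hgood,
      Measure.quasiMeasurePreserving_snd.ae hgood] with p hx hy
    obtain ⟨x, y⟩ := p
    simp only at hx hy
    have hslice : ∀ x, MeasurableSet {p : X × X | defect G ((x, p.1), p.2) ∉ U₂} := fun x => by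
      have : Measurable fun p : X × X => defect G ((x, p.1), p.2) := by fun_prop
      exact this hU₂o.measurableSet.compl
    have hx' := measure_slice_ge_lt (hslice x) h8 h8' hx
    have hy' := measure_slice_ge_lt (hslice y) h8 h8' hy
    obtain ⟨w, hwx, hwy, -⟩ := exists_notMem_of_measure_add_lt (m := m)
      (A := {w | 8⁻¹ ≤ m (Prod.mk w ⁻¹' {p : X × X | defect G ((x, p.1), p.2) ∉ U₂})})
      (B := {w | 8⁻¹ ≤ m (Prod.mk w ⁻¹' {p : X × X | defect G ((y, p.1), p.2) ∉ U₂})})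
      (C := ∅) (by
        rw [measure_empty, add_zero]
        refine (ENNReal.add_lt_add hx' hy').trans_le ?_
        have : (8⁻¹ + 8⁻¹ : ENNReal) = ENNReal.ofReal (1 / 4) := by
          rw [← ENNReal.toReal_eq_toReal_iff' (by finiteness) (by finiteness),
            ENNReal.toReal_add (by finiteness) (by finiteness)]
          norm_num
        rw [this]
        exact ENNReal.ofReal_le_one.2 (by norm_num))
    simp only [mem_ofPred_eq, not_le] at hwx hwy
    obtain ⟨n, hn⟩ := (TopologicalSpace.denseRange_denseSeq K).exists_mem_open
      (hU₂o.preimage (by fun_prop : Continuous fun k : K => defect G ((x, y), w) - k))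
      ⟨defect G ((x, y), w), by simpa using hU₂0⟩
    have hex : ∃ n, ν (x, y) {k | k - d n ∉ V₁} < 4⁻¹ := by
      refine ⟨n, ?_⟩
      rw [hνs]
      have hsub : {z | defect G ((x, y), z) - d n ∉ V₁} ⊆
          (Prod.mk w ⁻¹' {p : X × X | defect G ((x, p.1), p.2) ∉ U₂}) ∪
            (Prod.mk w ⁻¹' {p : X × X | defect G ((y, p.1), p.2) ∉ U₂}) := by
        intro z hz
        by_contra hc
        simp only [mem_union, mem_preimage, mem_ofPred_eq, not_or, not_not] at hc
        refine hz ?_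
        have e : defect G ((x, y), z) - d n = (defect G ((x, y), w) - d n) +
            defect G ((x, w), z) - defect G ((y, w), z) := by
          rw [defect_eq' G x y z w]
          abel
        rw [e]
        exact hU₂ _ hn _ hc.1 _ hc.2
      refine ((measure_mono hsub).trans (measure_union_le _ _)).trans_lt ?_
      refine (ENNReal.add_lt_add hwx hwy).trans_le (le_of_eq ?_)
      rw [← ENNReal.toReal_eq_toReal_iff' (by finiteness) (by finiteness),
        ENNReal.toReal_add (by finiteness) (by finiteness)]
      norm_num
    have := measure_sub_center_notMem_lt hex
    rwa [hνs] at this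
  refine ⟨fun p => G p - P p, hG.sub hP, h.sub_invariant fun γ => ?_, ?_⟩
  · filter_upwards [h.map_defect_invariant hS hG γ] with p hp
    exact congrArg (center d V₁) hp
  · filter_upwards [ae_forall_pairs hconc] with q ⟨h1, h2, h3⟩
    obtain ⟨⟨x, y⟩, z⟩ := q
    obtain ⟨w, hw1, hw2, hw3⟩ := exists_notMem_of_measure_add_lt
      ((ENNReal.add_lt_add (ENNReal.add_lt_add h1 h2) h3).trans_le (by
        have : (4⁻¹ + 4⁻¹ + 4⁻¹ : ENNReal) = ENNReal.ofReal (3 / 4) := by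
          rw [← ENNReal.toReal_eq_toReal_iff' (by finiteness) (by finiteness),
            ENNReal.toReal_add (by finiteness) (by finiteness),
            ENNReal.toReal_add (by finiteness) (by finiteness)]
          norm_num
        rw [this]
        exact ENNReal.ofReal_le_one.2 (by norm_num)))
    simp only [mem_ofPred_eq, not_not] at hw1 hw2 hw3
    have e : defect (fun p => G p - P p) ((x, y), z) = (defect G ((x, y), w) - P (x, y)) +
        (defect G ((y, z), w) - P (y, z)) - (defect G ((x, z), w) - P (x, z)) := by
      rw [defect_sub, defect_eq G x y z w]
      abel
    rw [e]
    exact hV₁ _ hw1 _ hw2 _ hw3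

section General

variable {Γ X K : Type*} [AddCommGroup Γ] [MeasurableSpace X] {m : Measure X}
  [IsProbabilityMeasure m] {S : Γ → X → X} [AddCommGroup K] [MeasurableSpace K]

/-- An additive primitive `G` is itself of the form `F y - F x`, and then `σ` differs from the
coboundary of `F` by a constant. -/
theorem isQuasiCoboundary_of_additive_primitive [MeasurableAdd₂ K] [MeasurableSub₂ K]
    [MeasurableEq K]
    (hS : ∀ γ, MeasurePreserving (S γ) m m) (hadd : ∀ γ₁ γ₂ x, S (γ₁ + γ₂) x = S γ₁ (S γ₂ x))
    {σ : Γ → X → K} (hσ : IsCocycle m S σ) {G : X × X → K} (hG : Measurable G)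
    (h : IsDifferencePrimitive m S σ G) (hd : ∀ᵐ q ∂(m.prod m).prod m, defect G q = 0) :
    IsQuasiCoboundary m S σ := by
  have h1 := Measure.ae_ae_of_ae_prod
    (((measurePreserving_prodAssoc m m m).symm _).quasiMeasurePreserving.ae hd)
  obtain ⟨x₀, hx₀⟩ := h1.exists
  let F : X → K := fun y => G (x₀, y)
  have hF : Measurable F := hG.comp measurable_prodMk_left
  have hGF : ∀ᵐ p ∂m.prod m, G p = F p.2 - F p.1 := by
    filter_upwards [hx₀] with p hp
    have hp' : G (x₀, p.1) + G p - G (x₀, p.2) = 0 := hp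
    rw [eq_sub_iff_add_eq, add_comm]
    exact sub_eq_zero.1 hp'
  have hc : ∀ γ, ∃ c, ∀ᵐ y ∂m, σ γ y = F (S γ y) - F y + c := by
    intro γ
    have h2 : ∀ᵐ p ∂m.prod m, σ γ p.2 - (F (S γ p.2) - F p.2) =
        σ γ p.1 - (F (S γ p.1) - F p.1) := by
      filter_upwards [h γ, hGF, ((hS γ).prod (hS γ)).quasiMeasurePreserving.ae hGF] with p a b c
      simp only [Prod.map] at c
      rw [b, c] at a
      rw [← sub_eq_zero] at a ⊢
      rw [← neg_eq_zero, ← a]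
      abel
    obtain ⟨x, hx⟩ := (Measure.ae_ae_of_ae_prod h2).exists
    refine ⟨σ γ x - (F (S γ x) - F x), hx.mono fun y hy => ?_⟩
    rw [← hy]
    abel
  choose c hc using hc
  have hcadd : ∀ γ₁ γ₂, c (γ₁ + γ₂) = c γ₁ + c γ₂ := by
    intro γ₁ γ₂
    obtain ⟨y, a, b, d, e⟩ := ((hc (γ₁ + γ₂)).and ((hc γ₂).and
      (((hS γ₂).quasiMeasurePreserving.ae (hc γ₁)).and (hσ.cocycle_eq γ₁ γ₂)))).exists
    rw [a, b, d, hadd, ← sub_eq_zero] at e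
    rw [← sub_eq_zero, ← e]
    abel
  exact ⟨F, hF, AddMonoidHom.mk' c hcadd, hc⟩

end General

/-- A cocycle with values in a compact abelian Lie group is a quasi-coboundary as soon as the
difference `σ (y) - σ (x)` has a primitive that is close to zero in measure. -/
theorem exists_nhds_isQuasiCoboundary {E K : Type*} [NormedAddCommGroup E] [NormedSpace ℝ E]
    [FiniteDimensional ℝ E] [AddCommGroup K] [TopologicalSpace K] [CompactSpace K] [T2Space K]
    [ChartedSpace E K] [LieAddGroup 𝓘(ℝ, E) ∞ K] [MeasurableSpace K] [BorelSpace K]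
    {Γ X : Type*} [AddCommGroup Γ] [Countable Γ] [MeasurableSpace X] {m : Measure X}
    [IsProbabilityMeasure m] {S : Γ → X → X} (hS : ∀ γ, MeasurePreserving (S γ) m m)
    (hadd : ∀ γ₁ γ₂ x, S (γ₁ + γ₂) x = S γ₁ (S γ₂ x)) (herg : IsErgodicSystem m S) :
    ∃ U : Set K, IsOpen U ∧ 0 ∈ U ∧ ∃ δ : ENNReal, 0 < δ ∧ ∀ (σ : Γ → X → K) (G : X × X → K),
      IsCocycle m S σ → Measurable G → IsDifferencePrimitive m S σ G →
      (m.prod m) {p | G p ∉ U} ≤ δ → IsQuasiCoboundary m S σ := by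
  have : IsTopologicalAddGroup K := topologicalAddGroup_of_lieAddGroup 𝓘(ℝ, E) ∞
  have : SecondCountableTopology K := ChartedSpace.secondCountable_of_sigmaCompact E K
  borelize E
  obtain ⟨L⟩ := nonempty_approxLog (E := E) (K := K)
  have hr := L.radius_pos
  obtain ⟨U, hU, hU0, δ, hδ, H⟩ := exists_small_defect_primitive (Γ := Γ) (m := m) (S := S)
    (L.hasBasis_nhds.mem_of_mem (show 0 < L.radius / 4 by positivity))
  refine ⟨U, hU, hU0, δ, hδ, fun σ G hσ hG h hsmall => ?_⟩
  obtain ⟨G₁, hG₁, h₁, hd₁⟩ := H σ G hS herg hG h hsmall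
  obtain ⟨G₂, hG₂, h₂, hd₂⟩ := L.exists_additive_primitive hS hG₁ h₁
    (show 0 ≤ L.radius / 4 by positivity) (by linarith) hd₁
  exact isQuasiCoboundary_of_additive_primitive hS hadd hσ hG₂ h₂ hd₂

/-! ### Continuity of translation -/

section Translation

variable {Y : Type*} [AddCommGroup Y] [TopologicalSpace Y] [IsTopologicalAddGroup Y]
  [CompactSpace Y] [TopologicalSpace.MetrizableSpace Y] [MeasurableSpace Y] [BorelSpace Y]
  (ν : Measure Y) [IsProbabilityMeasure ν] [ν.IsAddLeftInvariant]

theorem tendsto_measure_translate_diff {B : Set Y} (hB : MeasurableSet B) :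
    Tendsto (fun t => ν {y | y - t ∈ B ∧ y ∉ B}) (𝓝 0) (𝓝 0) := by
  rw [ENNReal.tendsto_nhds_zero]
  intro ε hε
  have hε2 : ε / 2 ≠ 0 := (ENNReal.half_pos hε.ne').ne'
  obtain ⟨C, hCB, hC, hCε⟩ := hB.exists_isCompact_sdiff_lt (measure_ne_top ν B) hε2
  have hlim := tendsto_measure_vadd_sdiff_isCompact_isClosed (μ := ν) hC hC.isClosed
  filter_upwards [hlim.eventually (gt_mem_nhds (ENNReal.half_pos hε.ne'))] with t ht
  have hsub : {y | y - t ∈ B ∧ y ∉ B} ⊆ ((t +ᵥ C) \ C) ∪ (fun y => -t + y) ⁻¹' (B \ C) := by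
    rintro y ⟨h1, h2⟩
    rw [sub_eq_neg_add] at h1
    by_cases hy : -t + y ∈ C
    · exact Or.inl ⟨⟨-t + y, hy, by simp⟩, fun h => h2 (hCB h)⟩
    · exact Or.inr ⟨h1, hy⟩
  calc ν {y | y - t ∈ B ∧ y ∉ B} ≤ ν ((t +ᵥ C) \ C) + ν ((fun y => -t + y) ⁻¹' (B \ C)) :=
        (measure_mono hsub).trans (measure_union_le _ _)
    _ ≤ ε / 2 + ε / 2 := by
        rw [measure_preimage_add]
        exact add_le_add ht.le hCε.le
    _ = ε := ENNReal.add_halves ε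

/-- Translation is continuous in measure on measurable maps into a separable group. -/
theorem eventually_measure_translate_sub_notMem_lt {K : Type*} [AddCommGroup K]
    [TopologicalSpace K] [IsTopologicalAddGroup K] [SecondCountableTopology K] [MeasurableSpace K]
    [BorelSpace K] {F : Y → K} (hF : Measurable F) {U : Set K} (hU : U ∈ 𝓝 (0 : K)) {δ : ENNReal}
    (hδ : 0 < δ) : ∀ᶠ t in 𝓝 (0 : Y), ν {y | F y - F (y - t) ∉ U} < δ := by
  classical
  obtain ⟨V, hVo, hV0, hV⟩ := exists_open_add_sub_mem hU
  let d : ℕ → K := TopologicalSpace.denseSeq K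
  let B : ℕ → Set Y := fun i => {y | F y - d i ∈ V}
  have hB : ∀ i, MeasurableSet (B i) := fun i => (hF.sub_const (d i)) hVo.measurableSet
  have hBu : ⋃ i, B i = univ := by
    refine eq_univ_of_forall fun y => ?_
    obtain ⟨i, hi⟩ := (TopologicalSpace.denseRange_denseSeq K).exists_mem_open
      (hVo.preimage (by fun_prop : Continuous fun k : K => F y - k)) ⟨F y, by simpa using hV0⟩
    exact mem_iUnion.2 ⟨i, hi⟩
  obtain ⟨δ', hδ'0, hδ'⟩ := exists_between hδ
  -- finitely many of the sets `B i` cover almost everything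
  obtain ⟨n, hn⟩ : ∃ n, ν (⋃ i < n, B i)ᶜ < δ' := by
    have hanti : Antitone fun n : ℕ => (⋃ i < n, B i)ᶜ := fun a b hab =>
      compl_subset_compl.2 (biUnion_subset_biUnion_left fun i hi => lt_of_lt_of_le hi hab)
    have ht := tendsto_measure_iInter_atTop (μ := ν) (s := fun n : ℕ => (⋃ i < n, B i)ᶜ)
      (fun n => (MeasurableSet.biUnion (to_countable _) fun i _ => hB i).compl.nullMeasurableSet)
      hanti ⟨0, measure_ne_top _ _⟩
    have hempty : ⋂ n : ℕ, (⋃ i < n, B i)ᶜ = ∅ := by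
      rw [← compl_iUnion, compl_empty_iff]
      refine eq_univ_of_forall fun y => ?_
      obtain ⟨i, hi⟩ := mem_iUnion.1 (hBu ▸ mem_univ y)
      exact mem_iUnion.2 ⟨i + 1, mem_biUnion (Nat.lt_succ_self i) hi⟩
    rw [hempty, measure_empty] at ht
    exact (ht.eventually (gt_mem_nhds hδ'0)).exists
  have hsum : Tendsto (fun t => ν (⋃ i < n, B i)ᶜ +
      ∑ i ∈ Finset.range n, ν {y | y - t ∈ B i ∧ y ∉ B i}) (𝓝 0)
      (𝓝 (ν (⋃ i < n, B i)ᶜ + ∑ i ∈ Finset.range n, 0)) :=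
    tendsto_const_nhds.add (tendsto_finsetSum _ fun i _ => tendsto_measure_translate_diff ν (hB i))
  rw [Finset.sum_const_zero, add_zero] at hsum
  filter_upwards [hsum.eventually (gt_mem_nhds (hn.trans hδ'))] with t ht
  refine lt_of_le_of_lt ?_ ht
  have hsub : {y | F y - F (y - t) ∉ U} ⊆ (fun y => -t + y) ⁻¹' (⋃ i < n, B i)ᶜ ∪
      ⋃ i ∈ Finset.range n, {y | y - t ∈ B i ∧ y ∉ B i} := by
    intro y hy
    by_contra hc
    simp only [mem_union, mem_preimage, mem_compl_iff, not_or, not_not, ← sub_eq_neg_add] at hc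
    obtain ⟨h1, h2⟩ := hc
    simp only [mem_iUnion, exists_prop] at h1
    obtain ⟨i, hi, hiB⟩ := h1
    have h3 : y ∈ B i := by
      by_contra hyB
      exact h2 (mem_biUnion (Finset.mem_coe.2 (Finset.mem_range.2 hi)) ⟨hiB, hyB⟩)
    refine hy ?_
    have := hV _ h3 _ hV0 _ hiB
    simpa using this
  refine (measure_mono hsub).trans ((measure_union_le _ _).trans ?_)
  rw [measure_preimage_add]
  exact add_le_add le_rfl (measure_biUnion_finset_le _ _)

end Translation

/-! ### From type two to the Conze--Lesigne equation -/

section Rotations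

variable {Γ Z K : Type*} [AddCommGroup Γ] [AddCommGroup Z] [MeasurableSpace Z]
  [AddCommGroup K] [MeasurableSpace K] {m : Measure Z} {φ : Γ →+ Z}

theorem IsQuasiCoboundary.neg [MeasurableNeg K] {σ : Γ → Z → K}
    (h : IsQuasiCoboundary m (rotation φ) σ) :
    IsQuasiCoboundary m (rotation φ) fun γ x => -σ γ x := by
  obtain ⟨F, hF, c, hc⟩ := h
  refine ⟨fun x => -F x, hF.neg, -c, fun γ => (hc γ).mono fun x hx => ?_⟩
  simp only [hx, AddMonoidHom.neg_apply]
  abel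

theorem IsQuasiCoboundary.add [MeasurableAdd₂ K] {σ τ : Γ → Z → K}
    (h : IsQuasiCoboundary m (rotation φ) σ) (h' : IsQuasiCoboundary m (rotation φ) τ) :
    IsQuasiCoboundary m (rotation φ) fun γ x => σ γ x + τ γ x := by
  obtain ⟨F, hF, c, hc⟩ := h
  obtain ⟨F', hF', c', hc'⟩ := h'
  refine ⟨fun x => F x + F' x, hF.add hF', c + c', fun γ => ?_⟩
  filter_upwards [hc γ, hc' γ] with x hx hx'
  rw [hx, hx', AddMonoidHom.add_apply]
  abel

variable [TopologicalSpace Z] [IsTopologicalAddGroup Z] [BorelSpace Z]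

theorem IsQuasiCoboundary.comp_add_left [m.IsAddLeftInvariant] {σ : Γ → Z → K}
    (h : IsQuasiCoboundary m (rotation φ) σ) (a : Z) :
    IsQuasiCoboundary m (rotation φ) fun γ x => σ γ (a + x) := by
  obtain ⟨F, hF, c, hc⟩ := h
  refine ⟨fun x => F (a + x), hF.comp (measurable_const_add a), c, fun γ => ?_⟩
  filter_upwards [(measurePreserving_add_left m a).quasiMeasurePreserving.ae (hc γ)] with x hx
  rw [hx]
  simp only [rotation, add_left_comm]

theorem IsCocycle.sub_translates [MeasurableSub₂ K] [m.IsAddLeftInvariant] {ρ : Γ → Z → K}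
    (hρ : IsCocycle m (rotation φ) ρ) (a b : Z) :
    IsCocycle m (rotation φ) fun γ x => ρ γ (a + x) - ρ γ (b + x) where
  measurable γ := ((hρ.measurable γ).comp (measurable_const_add a)).sub
    ((hρ.measurable γ).comp (measurable_const_add b))
  cocycle_eq γ₁ γ₂ := by
    have h := hρ.cocycle_eq γ₁ γ₂
    filter_upwards [(measurePreserving_add_left m a).quasiMeasurePreserving.ae h,
      (measurePreserving_add_left m b).quasiMeasurePreserving.ae h] with x h1 h2
    rw [h1, h2]
    simp only [rotation, add_left_comm]
    abel

/-- The translations along which the derivative of a cocycle is a quasi-coboundary. -/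
def quasiCoboundaryStabilizer [MeasurableAdd₂ K] [MeasurableNeg K] (m : Measure Z)
    [m.IsAddLeftInvariant] (φ : Γ →+ Z) (ρ : Γ → Z → K) : AddSubgroup Z where
  carrier := {t | IsQuasiCoboundary m (rotation φ) (cocycleDerivative (fun x => t + x) ρ)}
  zero_mem' := ⟨fun _ => 0, measurable_const, 0, fun γ => .of_forall fun x => by
    simp [cocycleDerivative]⟩
  add_mem' := by
    intro s t hs ht
    have h := (hs.comp_add_left t).add ht
    have e : cocycleDerivative (fun x => s + t + x) ρ = fun γ x =>
        cocycleDerivative (fun x => s + x) ρ γ (t + x) +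
          cocycleDerivative (fun x => t + x) ρ γ x := by
      funext γ x
      simp [cocycleDerivative, add_assoc]
    change IsQuasiCoboundary _ _ _
    rwa [e]
  neg_mem' := by
    intro t ht
    have h := (ht.comp_add_left (-t)).neg
    have e : cocycleDerivative (fun x => -t + x) ρ = fun γ x =>
        -cocycleDerivative (fun x => t + x) ρ γ (-t + x) := by
      funext γ x
      simp [cocycleDerivative]
    change IsQuasiCoboundary _ _ _
    rwa [e]

/-- The derivative along `φ γ` is the coboundary of `ρ γ`. -/
theorem map_mem_quasiCoboundaryStabilizer [MeasurableAdd₂ K] [MeasurableNeg K]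
    [m.IsAddLeftInvariant] {ρ : Γ → Z → K} (hρ : IsCocycle m (rotation φ) ρ) (γ : Γ) :
    φ γ ∈ quasiCoboundaryStabilizer m φ ρ := by
  refine ⟨ρ γ, hρ.measurable γ, 0, fun γ' => ?_⟩
  filter_upwards [hρ.cocycle_eq γ' γ, hρ.cocycle_eq γ γ'] with x h1 h2
  rw [add_comm, h2] at h1
  rw [AddMonoidHom.zero_apply, add_zero]
  exact sub_eq_sub_iff_add_eq_add.2 h1.symm

/-- By ergodicity, an open subgroup containing the image of `Γ` is everything. -/
theorem eq_top_of_isOpen_of_map_mem [IsProbabilityMeasure m] [m.IsOpenPosMeasure]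
    (hφ : IsErgodicSystem m (rotation φ)) (D : AddSubgroup Z) (hD : IsOpen (D : Set Z))
    (hmem : ∀ γ, φ γ ∈ D) : D = ⊤ := by
  have hinv : MeasurableSet[invariantAlgebra m (rotation φ)] (D : Set Z) :=
    ⟨hD.measurableSet, fun γ => by
      refine .of_eq (Set.ext fun x => ?_)
      exact D.add_mem_cancel_left (hmem γ)⟩
  have h1 : m D = 1 := (hφ _ hinv).resolve_left
    (hD.measure_ne_zero m ⟨0, D.zero_mem⟩)
  have h2 : m (D : Set Z)ᶜ = 0 := (prob_compl_eq_zero_iff hD.measurableSet).2 h1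
  have h3 : IsOpen (D : Set Z)ᶜ := (D.isClosed_of_isOpen hD).isOpen_compl
  have h4 : (D : Set Z)ᶜ = ∅ := (h3.measure_eq_zero_iff m).1 h2
  exact SetLike.coe_injective (compl_empty_iff.1 h4)

variable [Countable Γ] [CompactSpace Z] [TopologicalSpace.MetrizableSpace Z]

/-- Read on parallelograms, a primitive of the second difference of `ρ` provides, for almost every
translation, a primitive on `Z × Z` of the difference of the derivative of `ρ`. -/
theorem IsOfType.exists_difference_primitive [MeasurableSub₂ K]
    {μ : ProbabilityMeasure Z} [(μ : Measure Z).IsAddHaarMeasure]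
    (hφ : IsErgodicSystem (μ : Measure Z) (rotation φ)) {ρ : Γ → Z → K}
    (h : IsOfType μ (rotation φ) 2 ρ) :
    ∃ g : Z × Z × Z → K, Measurable g ∧ ∀ᵐ t ∂(μ : Measure Z),
      IsDifferencePrimitive (μ : Measure Z) (rotation φ) (cocycleDerivative (fun x => t + x) ρ)
        fun p => g (t, p) := by
  set m : Measure Z := (μ : Measure Z)
  obtain ⟨F, hF, hFeq⟩ := h
  refine ⟨fun q => F (parallelogram (q.2.1, q.1, q.2.2 - q.2.1)), ?_, ?_⟩
  · have := measurable_parallelogram (Z := Z)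
    fun_prop
  · have hmp := measurePreserving_parallelogram_sides m
    have hall : ∀ γ, ∀ᵐ t ∂m, ∀ᵐ p ∂m.prod m,
        F (parallelogram (rotation φ γ p.1, t, rotation φ γ p.2 - rotation φ γ p.1)) -
          F (parallelogram (p.1, t, p.2 - p.1)) =
        cocycleDerivative (fun x => t + x) ρ γ p.2 -
          cocycleDerivative (fun x => t + x) ρ γ p.1 := by
      intro γ
      have h1 := hFeq γ
      rw [hostKraMeasure_two_eq_map μ φ hφ] at h1
      have h2 := ae_of_ae_map measurable_parallelogram.aemeasurable h1
      have h3 := Measure.ae_ae_of_ae_prod (hmp.quasiMeasurePreserving.ae h2)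
      refine h3.mono fun t ht => ht.mono fun p hp => ?_
      rw [cubeDifference_two, cubeAction_parallelogram] at hp
      simp only [parallelogram, Matrix.cons_val_zero, Matrix.cons_val_one, if_true,
        Bool.false_eq_true, if_false, add_zero] at hp
      have e1 : p.1 + t + (p.2 - p.1) = t + p.2 := by abel
      have e2 : p.1 + (p.2 - p.1) = p.2 := by abel
      have e3 : p.1 + t = t + p.1 := by abel
      have e4 : rotation φ γ p.2 - rotation φ γ p.1 = p.2 - p.1 := by simp [rotation]
      rw [e1, e2, e3] at hp
      rw [e4]
      refine hp.symm.trans ?_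
      simp only [cocycleDerivative]
      abel
    exact ae_all_iff.2 hall

/-- For small `t` the primitives attached to `s` and to `s - t` are close, so that
`ρ (s + x) - ρ (s - t + x)`, a translate of the derivative along `t`, is a quasi-coboundary; the
translations with this property form an open subgroup containing the image of `Γ`. -/
theorem IsOfType.obeysConzeLesigne {E : Type*} [NormedAddCommGroup E] [NormedSpace ℝ E]
    [FiniteDimensional ℝ E] [TopologicalSpace K] [CompactSpace K] [T2Space K]
    [ChartedSpace E K] [LieAddGroup 𝓘(ℝ, E) ∞ K] [BorelSpace K]
    {μ : ProbabilityMeasure Z} [(μ : Measure Z).IsAddHaarMeasure]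
    (hφ : IsErgodicSystem (μ : Measure Z) (rotation φ)) {ρ : Γ → Z → K}
    (hρ : IsCocycle (μ : Measure Z) (rotation φ) ρ)
    (h : IsOfType μ (rotation φ) 2 ρ) : ObeysConzeLesigne (μ : Measure Z) φ ρ := by
  have : IsTopologicalAddGroup K := topologicalAddGroup_of_lieAddGroup 𝓘(ℝ, E) ∞
  have : SecondCountableTopology K := ChartedSpace.secondCountable_of_sigmaCompact E K
  set m : Measure Z := (μ : Measure Z)
  obtain ⟨g, hg, hgp⟩ := h.exists_difference_primitive hφ
  obtain ⟨U, hUo, hU0, δ, hδ, H⟩ := exists_nhds_isQuasiCoboundary (E := E) (K := K)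
    (measurePreserving_rotation m φ) (fun γ₁ γ₂ x => by simp [rotation, add_assoc]) hφ
  have hnear := eventually_measure_translate_sub_notMem_lt (m.prod (m.prod m)) hg (hUo.mem_nhds hU0) hδ
  have hemb : Tendsto (fun t : Z => ((t, 0, 0) : Z × Z × Z)) (𝓝 0) (𝓝 0) :=
    (by fun_prop : Continuous fun t : Z => ((t, 0, 0) : Z × Z × Z)).tendsto' _ _ rfl
  have hD : ∀ᶠ t in 𝓝 (0 : Z), t ∈ quasiCoboundaryStabilizer m φ ρ := by
    filter_upwards [hemb.eventually hnear] with t ht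
    -- choose a typical `s` for which the primitives at `s` and at `s - t` are close
    have hgp' : ∀ᵐ s ∂m, IsDifferencePrimitive m (rotation φ)
        (cocycleDerivative (fun x => -t + s + x) ρ) fun p => g (-t + s, p) :=
      (measurePreserving_add_left m (-t)).quasiMeasurePreserving.ae hgp
    obtain ⟨s, hs1, hs2, hs3⟩ : ∃ s, IsDifferencePrimitive m (rotation φ)
        (cocycleDerivative (fun x => s + x) ρ) (fun p => g (s, p)) ∧
        IsDifferencePrimitive m (rotation φ)
        (cocycleDerivative (fun x => -t + s + x) ρ) (fun p => g (-t + s, p)) ∧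
        (m.prod m) {p | g (s, p) - g (-t + s, p) ∉ U} ≤ δ := by
      by_contra! hcon
      refine ht.not_ge ?_
      calc δ = ∫⁻ _, δ ∂m := by simp
        _ ≤ ∫⁻ s, (m.prod m) (Prod.mk s ⁻¹'
              {y : Z × Z × Z | g y - g (y - (t, 0, 0)) ∉ U}) ∂m := by
            refine lintegral_mono_ae ?_
            filter_upwards [hgp, hgp'] with s h1 h2
            refine (hcon s h1 h2).le.trans (le_of_eq ?_)
            congr 1
            ext ⟨x, y⟩
            simp [sub_eq_neg_add]
        _ = (m.prod (m.prod m)) {y | g y - g (y - (t, 0, 0)) ∉ U} := by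
            refine (Measure.prod_apply ?_).symm
            exact (hg.sub (hg.comp (measurable_id.sub_const _))) hUo.measurableSet.compl
    have hprim : IsDifferencePrimitive m (rotation φ)
        (fun γ x => ρ γ (s + x) - ρ γ (-t + s + x)) fun p => g (s, p) - g (-t + s, p) := by
      intro γ
      filter_upwards [hs1 γ, hs2 γ] with p h1 h2
      simp only [cocycleDerivative] at h1 h2
      rw [sub_sub_sub_comm, h1, h2]
      abel
    have hq := H _ _ (hρ.sub_translates s (-t + s))
      ((hg.comp measurable_prodMk_left).sub (hg.comp measurable_prodMk_left)) hprim hs3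
    have hq' := hq.comp_add_left (t - s)
    have e : cocycleDerivative (fun x => t + x) ρ = fun γ x =>
        ρ γ (s + (t - s + x)) - ρ γ (-t + s + (t - s + x)) := by
      funext γ x
      simp only [cocycleDerivative]
      congr 2 <;> abel
    change IsQuasiCoboundary _ _ _
    rwa [e]
  have hopen : IsOpen (quasiCoboundaryStabilizer m φ ρ : Set Z) :=
    AddSubgroup.isOpen_of_mem_nhds _ hD
  have htop := eq_top_of_isOpen_of_map_mem hφ _ hopen (map_mem_quasiCoboundaryStabilizer hρ)
  intro t
  have : t ∈ quasiCoboundaryStabilizer m φ ρ := htop ▸ AddSubgroup.mem_top t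
  exact this

end Rotations

end ConzeLesigne

open ConzeLesigne ContDiff in
theorem theorem1p7
    -- a torsion-free countable (discrete) abelian group
    {Γ : Type*} [AddCommGroup Γ] [Countable Γ] [IsAddTorsionFree Γ]
    -- an ergodic metrizable rotational system: a compact metrizable abelian group `Z` with its
    -- Haar probability measure, on which `Γ` acts by translations through `φ : Γ → Z`
    {Z : Type*} [AddCommGroup Z] [TopologicalSpace Z] [IsTopologicalAddGroup Z]
    [CompactSpace Z] [TopologicalSpace.MetrizableSpace Z] [MeasurableSpace Z] [BorelSpace Z]
    (μ : ProbabilityMeasure Z) [(μ : Measure Z).IsAddHaarMeasure]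
    (φ : Γ →+ Z) (hφ : IsErgodicSystem (μ : Measure Z) (rotation φ))
    -- a compact abelian Lie group
    {E : Type*} [NormedAddCommGroup E] [NormedSpace ℝ E] [FiniteDimensional ℝ E]
    {K : Type*} [AddCommGroup K] [TopologicalSpace K] [CompactSpace K] [T2Space K]
    [ChartedSpace E K] [LieAddGroup (modelWithCornersSelf ℝ E) ∞ K]
    [MeasurableSpace K] [BorelSpace K]
    -- a cocycle
    (ρ : Γ → Z → K) (hρ : IsCocycle (μ : Measure Z) (rotation φ) ρ) :
    IsOfType μ (rotation φ) 2 ρ ↔ ObeysConzeLesigne (μ : Measure Z) φ ρ := by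
  have : IsTopologicalAddGroup K := topologicalAddGroup_of_lieAddGroup (modelWithCornersSelf ℝ E) ∞
  have : SecondCountableTopology K := ChartedSpace.secondCountable_of_sigmaCompact E K
  exact ⟨fun h => h.obeysConzeLesigne (E := E) hφ hρ, fun h => h.isOfType_two μ φ hφ hρ.measurable⟩
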